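/- Let $G$ be a complex semisimple Lie group with Cartan subalgebra $\mathfrak h$, root system $\Delta\subset\mathfrak h^*$, positive roots $\Delta_+$, simple roots $\Sigma$ and Weyl group $W$ with length function $l$. Let $V=\bigoplus_{\alpha\in\Delta_+}\mathbf C[\alpha]$ be the Yetter–Drinfeld module over $W$ spanned by symbols $[\alpha]$, $\alpha\in\Delta$, with $[-\alpha]=-[\alpha]$, $W$-action $w.[\alpha]=[w(\alpha)]$ and $[\alpha]$ of $W$-degree $s_\alpha$, so that its braiding is $\psi([\alpha]\otimes[\beta])=[s_\alpha(\beta)]\otimes[\alpha]$. Let $\mathcal B(V)=T(V)/I(V)$ be its Nichols algebra, $I(V)$ being the kernel of the duality pairing between the braided Hopf algebras $T(V^*)$ and $T(V)$, i.e. the pairing with $\langle 1,x\rangle=\varepsilon(x)$ and $\langle\xi\eta,x\rangle=\langle\xi,x_{(2)}\rangle\langle\eta,x_{(1)}\rangle$ that extends the evaluation $V^*\times V\to\mathbf C$. Identify $\mathcal B(V^*)$ with $\mathcal B(V)$ by the pairing $\langle[\alpha],[\beta]\rangle=\delta_{\alpha,\beta}$ ($\alpha,\beta\in\Delta_+$).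 Let $\tilde{\mathcal B}(V)$ be the space $\mathcal B(V)$ with the product $a*b=m(\psi^{-1}(a\otimes b))$, where $m$ is the product and $\psi$ the braiding of $\mathcal B(V)$. For $\alpha\in\Delta_+$ let $\bar D_\alpha$ be the linear operator on $\mathcal B(V^*)$ with $\bar D_\alpha([\beta])=\delta_{\alpha,\beta}$ for $\beta\in\Delta_+$ and $\bar D_\alpha(xy)=\bar D_\alpha(x)y+s_\alpha(x)\bar D_\alpha(y)$, and give $\mathcal B(V^*)\otimes\tilde{\mathcal B}(V)$ the algebra structure determined by $(x\otimes 1)(u\otimes v)=xu\otimes v$ and $$(x\otimes[\alpha])(u\otimes v)=x\bar D_\alpha(u)\otimes v+x\,s_\alpha(u)\otimes[\alpha]*v .$$ Let $R=\mathbf C[q^{\alpha^\vee}\mid\alpha\in\Sigma]$ be the polynomial ring, with $q^{\alpha^\vee}=\prod_i(q^{\alpha_i^\vee})^{m_i}$ and $\mathrm{ht}(\alpha^\vee)=\sum_i m_i$ for $\alpha\in\Delta_+$ with $\alpha^\vee=\sum_i m_i\alpha_i^\vee$, $\alpha_i\in\Sigma$; a subscript $R$ denotes extension of scalars from $\mathbf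 C$ to $R$. Let $\tilde\Delta_+$ be the set of $\alpha\in\Delta_+$ with $l(s_\alpha)=2\,\mathrm{ht}(\alpha^\vee)-1$. Let $(c_\alpha)_{\alpha\in\Delta}$ be nonzero complex numbers with $c_{w\alpha}=c_\alpha$ for all $w\in W$. For $\alpha\in\tilde\Delta_+$ choose a reduced decomposition $s_\alpha=s_{\alpha_1}\cdots s_{\alpha_l}$ with $\alpha_1,\dots,\alpha_l\in\Sigma$ and put $d_\alpha=(c_{\alpha_1}\cdots c_{\alpha_l})^{-1}$. For $\alpha\in\Delta_+$ define in $\mathcal B_R(V^*)\otimes_R\tilde{\mathcal B}_R(V)$ $$\widetilde{[\alpha]}=\begin{cases}c_\alpha[\alpha]\otimes1+d_\alpha q^{\alpha^\vee}\otimes[\alpha_1]*\cdots*[\alpha_l],&\alpha\in\tilde\Delta_+,\\ c_\alpha[\alpha]\otimes1,&\text{otherwise,}\end{cases}$$ and let $\tilde\mu:\mathfrak h_R\to\mathcal B_R(V^*)\otimes_R\tilde{\mathcal B}_R(V)$ be the $R$-linear map $\tilde\mu(x)=\sum_{\alpha\in\Delta_+}(x,\alpha)\widetilde{[\alpha]}$,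 where $(x,\alpha)$ is the value of $\alpha$ at $x$. Then the $R$-subalgebra of $\mathcal B_R(V^*)\otimes_R\tilde{\mathcal B}_R(V)$ generated by $\mathrm{Im}(\tilde\mu)$ is commutative. -/

import Mathlib

open scoped TensorProduct

noncomputable section

namespace RootNichols

variable {ι M N : Type*} [AddCommGroup M] [Module ℂ M] [AddCommGroup N] [Module ℂ N]
  (P : RootPairing ι ℂ M N)

/-! ### Reflections and negation of roots -/

/-- The reflection `s_α` as an element of the Weyl group. -/
def s (i : ι) : P.weylGroup := RootPairing.weylGroup.ofIdx P i

/-- The index of the root `-α`, that is, of `s_α(α)`. -/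
def neg (i : ι) : ι := P.reflectionPerm i i

theorem root_neg (i : ι) : P.root (neg P i) = -P.root i := by
  simp [neg]

theorem root_smul (w : P.weylGroup) (i : ι) : P.root (w • i) = w • P.root i :=
  RootPairing.Equiv.root_indexEquiv_eq_smul P i w.1

theorem s_smul_self (i : ι) : s P i • i = neg P i := rfl

theorem weyl_ext {w w' : P.weylGroup} (h : ∀ m : M, w • m = w' • m) : w = w' := by
  apply Subtype.ext
  apply RootPairing.Equiv.weightHom_injective P
  ext m
  exact h m

theorem s_smul_vec (i : ι) (m : M) : s P i • m = P.reflection i m := rfl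

theorem s_mul_self (i : ι) : s P i * s P i = 1 := by
  apply weyl_ext
  intro m
  rw [mul_smul, s_smul_vec, s_smul_vec]
  simp

theorem s_inv (i : ι) : (s P i)⁻¹ = s P i := inv_eq_of_mul_eq_one_left (s_mul_self P i)

theorem s_smul (w : P.weylGroup) (i : ι) : s P (w • i) = w * s P i * w⁻¹ := by
  rw [eq_mul_inv_iff_mul_eq]
  apply weyl_ext
  intro m
  rw [mul_smul, mul_smul, s_smul_vec, s_smul_vec, RootPairing.reflection_apply,
    RootPairing.reflection_apply, root_smul, smul_sub, smul_comm w]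
  congr 2
  have h := RootPairing.Hom.weight_coweight_transpose_apply P P (P.coroot (w • i)) w.1.toHom
  have h2 := RootPairing.Hom.coroot_coweightMap_apply P P (w • i) w.1.toHom
  have h3 : w.1.toHom.indexEquiv.symm (w • i) = i := Equiv.symm_apply_apply w.1.toHom.indexEquiv i
  have h4 := LinearMap.congr_fun h m
  rw [h2, h3] at h4
  exact h4

theorem s_neg (i : ι) : s P (neg P i) = s P i := by
  rw [← s_smul_self, s_smul, s_mul_self, one_mul, s_inv]

theorem neg_neg (i : ι) : neg P (neg P i) = i := by
  rw [← s_smul_self P (neg P i), s_neg, ← s_smul_self P i, ← mul_smul, s_mul_self, one_smul]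

theorem smul_neg (w : P.weylGroup) (i : ι) : w • neg P i = neg P (w • i) := by
  rw [← s_smul_self, ← s_smul_self, s_smul, ← mul_smul, ← mul_smul]
  simp

/-! ### The Yetter-Drinfeld module `V` -/

/-- The space `V`: it is spanned by symbols `[α]`, one for every root `α`, subject to
`[-α] = -[α]`. -/
def V : Type _ :=
  (ι →₀ ℂ) ⧸ Submodule.span ℂ
    (Set.range fun i : ι => Finsupp.single i (1 : ℂ) + Finsupp.single (neg P i) (1 : ℂ))

instance : AddCommGroup (V P) := inferInstanceAs (AddCommGroup ((ι →₀ ℂ) ⧸ Submodule.span ℂ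
    (Set.range fun i : ι => Finsupp.single i (1 : ℂ) + Finsupp.single (neg P i) (1 : ℂ))))

instance : Module ℂ (V P) := inferInstanceAs (Module ℂ ((ι →₀ ℂ) ⧸ Submodule.span ℂ
    (Set.range fun i : ι => Finsupp.single i (1 : ℂ) + Finsupp.single (neg P i) (1 : ℂ))))

/-- The quotient map onto `V`. -/
def mkV : (ι →₀ ℂ) →ₗ[ℂ] V P := Submodule.mkQ _

/-- The symbol `[α]`. -/
def br (i : ι) : V P := mkV P (Finsupp.single i 1)

theorem br_neg (i : ι) : br P (neg P i) = -br P i := by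
  rw [eq_neg_iff_add_eq_zero, add_comm]
  unfold br
  rw [← map_add]
  exact (Submodule.Quotient.mk_eq_zero _).2 (Submodule.subset_span ⟨i, rfl⟩)

/-- The universal property of `V`: a family `f` with `f (-α) = -f α` extends linearly. -/
def liftV {E : Type*} [AddCommGroup E] [Module ℂ E] (f : ι → E)
    (hf : ∀ i, f (neg P i) = -f i) : V P →ₗ[ℂ] E :=
  Submodule.liftQ _ (Finsupp.linearCombination ℂ f) (by
    rw [Submodule.span_le]
    rintro _ ⟨i, rfl⟩
    simp [hf])

@[simp] theorem liftV_br {E : Type*} [AddCommGroup E] [Module ℂ E] (f : ι → E)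
    (hf : ∀ i, f (neg P i) = -f i) (i : ι) : liftV P f hf (br P i) = f i := by
  have : liftV P f hf (br P i) = Finsupp.linearCombination ℂ f (Finsupp.single i 1) := rfl
  rw [this]
  simp

theorem span_br : Submodule.span ℂ (Set.range (br P)) = ⊤ := by
  rw [eq_top_iff]
  rintro v -
  obtain ⟨x, rfl⟩ := Submodule.mkQ_surjective _ v
  induction x using Finsupp.induction_linear with
  | zero => exact zero_mem (Submodule.span ℂ (Set.range (br P)))
  | add f g hf hg => exact add_mem hf hg
  | single i a =>
    have : (Finsupp.single i a : ι →₀ ℂ) = a • Finsupp.single i 1 := by simp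
    rw [this, map_smul]
    exact Submodule.smul_mem _ _ (Submodule.subset_span ⟨i, rfl⟩)

theorem V_ext {E : Type*} [AddCommGroup E] [Module ℂ E] {f g : V P →ₗ[ℂ] E}
    (h : ∀ i, f (br P i) = g (br P i)) : f = g := by
  apply LinearMap.ext_on_range (span_br P) h

open Classical in
/-- `⟨[α], [β]⟩ = δ_{α,β} - δ_{α,-β}`. For positive roots `α`, `β` this is `δ_{α,β}`. -/
def pr (i j : ι) : ℂ := (if i = j then 1 else 0) - (if i = neg P j then 1 else 0)

theorem pr_neg_right (i j : ι) : pr P i (neg P j) = -pr P i j := by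
  classical
  unfold pr
  rw [if_congr (iff_of_eq (congrArg (i = ·) (neg_neg P j))) rfl rfl]
  ring

theorem pr_smul (w : P.weylGroup) (i j : ι) : pr P (w • i) (w • j) = pr P i j := by
  classical
  unfold pr
  rw [if_congr (smul_left_cancel_iff w) rfl rfl, ← smul_neg,
    if_congr (smul_left_cancel_iff w) rfl rfl]

theorem pr_comm (i j : ι) : pr P i j = pr P j i := by
  have h : i = neg P j ↔ j = neg P i := by
    constructor <;> (intro h; rw [h, neg_neg])
  classical
  unfold pr
  rw [if_congr h rfl rfl, if_congr (eq_comm (a := i) (b := j)) rfl rfl]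

theorem s_eq_of_pr_ne_zero {i j : ι} (h : pr P i j ≠ 0) : s P j = s P i := by
  unfold pr at h
  by_cases h1 : i = j
  · rw [h1]
  · by_cases h2 : i = neg P j
    · rw [h2, s_neg]
    · simp [h1, h2] at h

/-- The linear form `⟨[α], · ⟩` on `V`. -/
def co (i : ι) : Module.Dual ℂ (V P) := liftV P (pr P i) (pr_neg_right P i)

@[simp] theorem co_br (i j : ι) : co P i (br P j) = pr P i j := liftV_br P _ _ j

theorem dual_eq_sum [Fintype ι] (f : Module.Dual ℂ (V P)) :
    f = ∑ i, ((1 / 2 : ℂ) * f (br P i)) • co P i := by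
  apply V_ext
  intro j
  classical
  have h : ∀ k : ι, ∑ i, (if i = k then (1 / 2 : ℂ) * f (br P i) else 0) =
      (1 / 2 : ℂ) * f (br P k) := fun k => by
    rw [Finset.sum_ite_eq' Finset.univ k, if_pos (Finset.mem_univ k)]
  have h2 : ∀ i : ι, ((1 / 2 : ℂ) * f (br P i)) * pr P i j =
      (if i = j then (1 / 2 : ℂ) * f (br P i) else 0) -
      (if i = neg P j then (1 / 2 : ℂ) * f (br P i) else 0) := fun i => by
    unfold pr
    split_ifs <;> ring
  simp only [LinearMap.sum_apply, LinearMap.smul_apply, co_br, smul_eq_mul]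
  rw [Finset.sum_congr rfl fun i _ => h2 i, Finset.sum_sub_distrib, h, h, br_neg, map_neg]
  ring

/-! ### The tensor algebra -/

/-- The tensor algebra `T(V)`. -/
abbrev T : Type _ := TensorAlgebra ℂ (V P)

/-- The generator `[α]` of `T(V)`. -/
def tb (i : ι) : T P := TensorAlgebra.ι ℂ (br P i)

theorem tb_neg (i : ι) : tb P (neg P i) = -tb P i := by
  simp [tb, br_neg]

/-- Algebra maps out of `T(V)`. -/
def liftT {A : Type*} [Ring A] [Algebra ℂ A] (f : ι → A) (hf : ∀ i, f (neg P i) = -f i) :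
    T P →ₐ[ℂ] A := TensorAlgebra.lift ℂ (liftV P f hf)

@[simp] theorem liftT_tb {A : Type*} [Ring A] [Algebra ℂ A] (f : ι → A)
    (hf : ∀ i, f (neg P i) = -f i) (i : ι) : liftT P f hf (tb P i) = f i := by
  simp [liftT, tb]

theorem T_induction {C : T P → Prop} (h1 : C 1) (hadd : ∀ x y, C x → C y → C (x + y))
    (hsmul : ∀ (a : ℂ) x, C x → C (a • x)) (hmul : ∀ i x, C x → C (tb P i * x)) (x : T P) :
    C x := by
  have h0 : C 0 := by simpa using hsmul 0 1 h1
  have key : ∀ x y, C y → C (x * y) := by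
    intro x
    induction x using TensorAlgebra.induction with
    | algebraMap r =>
      intro y hy
      rw [← Algebra.smul_def]
      exact hsmul r y hy
    | ι v =>
      intro y hy
      have hv : v ∈ Submodule.span ℂ (Set.range (br P)) := by rw [span_br]; trivial
      induction hv using Submodule.span_induction with
      | mem v hv => obtain ⟨i, rfl⟩ := hv; exact hmul i y hy
      | zero => simpa using h0
      | add a b _ _ ha hb => rw [map_add, add_mul]; exact hadd _ _ ha hb
      | smul a v _ hv => rw [map_smul, smul_mul_assoc]; exact hsmul _ _ hv
    | mul a b ha hb => intro y hy; rw [mul_assoc]; exact ha _ (hb _ hy)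
    | add a b ha hb => intro y hy; rw [add_mul]; exact hadd _ _ (ha _ hy) (hb _ hy)
  simpa using key x 1 h1

theorem T_lin_ext {E : Type*} [AddCommGroup E] [Module ℂ E] {f g : T P →ₗ[ℂ] E}
    (h1 : f 1 = g 1) (h : ∀ i x, f x = g x → f (tb P i * x) = g (tb P i * x)) : f = g := by
  ext1 x
  refine T_induction P (C := fun x => f x = g x) h1 ?_ ?_ h x
  · intro x y hx hy
    rw [map_add, map_add, hx, hy]
  · intro a x hx
    rw [map_smul, map_smul, hx]

/-- The action of `W` on `T(V)` by algebra automorphisms, `w.[α] = [w(α)]`. -/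
def tAct (w : P.weylGroup) : T P →ₐ[ℂ] T P :=
  liftT P (fun i => tb P (w • i)) (fun i => by rw [smul_neg, tb_neg])

@[simp] theorem tAct_tb (w : P.weylGroup) (i : ι) : tAct P w (tb P i) = tb P (w • i) :=
  liftT_tb P _ _ i

theorem tAct_mul (w w' : P.weylGroup) (x : T P) : tAct P (w * w') x = tAct P w (tAct P w' x) := by
  refine T_induction P (C := fun x => tAct P (w * w') x = tAct P w (tAct P w' x)) ?_ ?_ ?_ ?_ x
  · simp
  · intro x y hx hy; simp [hx, hy]
  · intro a x hx; simp [hx]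
  · intro i x hx; simp [hx, mul_smul]

theorem tAct_one (x : T P) : tAct P 1 x = x := by
  refine T_induction P (C := fun x => tAct P 1 x = x) ?_ ?_ ?_ ?_ x
  · simp
  · intro x y hx hy; simp [hx, hy]
  · intro a x hx; simp [hx]
  · intro i x hx; simp [hx]

/-- The `W`-grading of `T(V)`, with `[α]` of degree `s_α`, written as the algebra map
`x ↦ ∑_g x_g g` into the group algebra over `T(V)`, where `x_g` is the component of degree `g`. -/
def coactT : T P →ₐ[ℂ] MonoidAlgebra (T P) P.weylGroup :=
  liftT P (fun i => MonoidAlgebra.single (s P i) (tb P i)) (fun i => by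
    rw [s_neg, tb_neg]; ext; simp)

/-- The component of degree `g` of an element of `T(V)`. -/
def compT (g : P.weylGroup) : T P →ₗ[ℂ] T P :=
  Finsupp.lapply g ∘ₗ (MonoidAlgebra.coeffLinearEquiv ℂ).toLinearMap ∘ₗ (coactT P).toLinearMap

theorem compT_apply (g : P.weylGroup) (x : T P) : compT P g x = (coactT P x).coeff g := rfl

open Classical in
theorem compT_one (g : P.weylGroup) : compT P g 1 = if g = 1 then 1 else 0 := by
  rw [compT_apply, map_one, MonoidAlgebra.one_def, MonoidAlgebra.coeff_single,
    Finsupp.single_apply]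
  simp [eq_comm]

theorem compT_step (g : P.weylGroup) (i : ι) (x : T P) :
    compT P g (tb P i * x) = tb P i * compT P (s P i * g) x := by
  rw [compT_apply, map_mul, coactT, liftT_tb, MonoidAlgebra.coeff_single_mul_apply, s_inv]
  rfl

/-! ### The braided coproduct and the duality pairing -/

/-- Left multiplication by `[α] ⊗ 1 + 1 ⊗ [α]` on the braided tensor square `T(V) ⊗ T(V)`, whose
product is `(a ⊗ b)(c ⊗ d) = a (g.c) ⊗ b d` for `b` of degree `g`. -/
def coprodStep (i : ι) : Module.End ℂ (T P ⊗[ℂ] T P) :=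
  TensorProduct.map (LinearMap.mulLeft ℂ (tb P i)) LinearMap.id +
    TensorProduct.map (tAct P (s P i)).toLinearMap (LinearMap.mulLeft ℂ (tb P i))

@[simp] theorem coprodStep_tmul (i : ι) (c d : T P) : coprodStep P i (c ⊗ₜ d) =
    (tb P i * c) ⊗ₜ d + tAct P (s P i) c ⊗ₜ (tb P i * d) := by
  simp [coprodStep]

/-- The coproduct of the braided Hopf algebra `T(V)`: it is the algebra map into the braided
tensor square with `△([α]) = [α] ⊗ 1 + 1 ⊗ [α]`; in other words `△(1) = 1 ⊗ 1` and
`△([α] x) = ([α] ⊗ 1 + 1 ⊗ [α]) △(x)`. -/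
def coprod : T P →ₗ[ℂ] T P ⊗[ℂ] T P :=
  LinearMap.applyₗ (1 ⊗ₜ 1 : T P ⊗[ℂ] T P) ∘ₗ
    (liftT P (coprodStep P) (fun i => by
      ext1
      apply LinearMap.ext; intro c
      apply LinearMap.ext; intro d
      simp [tb_neg, s_neg, TensorProduct.neg_tmul, TensorProduct.tmul_neg]
      abel)).toLinearMap

@[simp] theorem coprod_one : coprod P 1 = 1 ⊗ₜ 1 := by simp [coprod]

@[simp] theorem coprod_step (i : ι) (x : T P) :
    coprod P (tb P i * x) = coprodStep P i (coprod P x) := by simp [coprod]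

/-- The counit of `T(V)`. -/
def counit : T P →ₐ[ℂ] ℂ := TensorAlgebra.algebraMapInv

@[simp] theorem counit_tb (i : ι) : counit P (tb P i) = 0 := by
  simp [counit, tb, TensorAlgebra.algebraMapInv]

/-- The pairing of `f ∈ V*` with an element of `T(V)`: `f` applied to the component in `V`. -/
def pairOne (f : Module.Dual ℂ (V P)) : T P →ₗ[ℂ] ℂ := f ∘ₗ TensorAlgebra.ιInv

/-- The map `x ↦ x₍₁₎ ⟨f, x₍₂₎⟩` on `T(V)`. -/
def D (f : Module.Dual ℂ (V P)) : T P →ₗ[ℂ] T P :=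
  (TensorProduct.rid ℂ (T P)).toLinearMap ∘ₗ LinearMap.lTensor (T P) (pairOne P f) ∘ₗ coprod P

/-- The duality pairing `T(V*) × T(V) → ℂ`, the one with `⟨1, x⟩ = ε(x)` and
`⟨f η, x⟩ = ⟨f, x₍₂₎⟩ ⟨η, x₍₁₎⟩` for `f ∈ V*`. -/
def pairing : TensorAlgebra ℂ (Module.Dual ℂ (V P)) →ₗ[ℂ] Module.Dual ℂ (T P) :=
  LinearMap.applyₗ (counit P).toLinearMap ∘ₗ
    (TensorAlgebra.lift ℂ
      { toFun := fun f => (LinearMap.lcomp ℂ ℂ (D P f) : Module.End ℂ (Module.Dual ℂ (T P)))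
        map_add' := fun f g => by
          ext φ x
          simp [D, pairOne, LinearMap.add_comp, LinearMap.lTensor_add]
        map_smul' := fun a f => by
          ext φ x
          simp [D, pairOne, LinearMap.smul_comp, LinearMap.lTensor_smul] }).toLinearMap

theorem pairing_one (x : T P) : pairing P 1 x = counit P x := by
  simp [pairing]

theorem pairing_step (f : Module.Dual ℂ (V P)) (η : TensorAlgebra ℂ (Module.Dual ℂ (V P)))
    (x : T P) : pairing P (TensorAlgebra.ι ℂ f * η) x = pairing P η (D P f x) := by
  simp [pairing]


/-! ### Elementary properties of the coproduct and of the pairing -/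

theorem ιInv_mul (i : ι) (d : T P) :
    TensorAlgebra.ιInv (tb P i * d) = counit P d • br P i := by
  let _i1 : Module ℂᵐᵒᵖ (V P) := Module.compHom _ ((RingHom.id ℂ).fromOpposite mul_comm)
  have _i2 : IsCentralScalar ℂ (V P) := ⟨fun r m => rfl⟩
  have hf : ∀ y : T P, (TensorAlgebra.toTrivSqZeroExt y).fst = counit P y := by
    have : (TrivSqZeroExt.fstHom ℂ ℂ (V P)).comp TensorAlgebra.toTrivSqZeroExt = counit P := by
      ext v
      simp [counit, TensorAlgebra.algebraMapInv]
    exact fun y => AlgHom.congr_fun this y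
  have h : ∀ y : T P, TensorAlgebra.ιInv y = (TensorAlgebra.toTrivSqZeroExt y).snd := fun y => rfl
  rw [h, map_mul, TrivSqZeroExt.snd_mul, hf, hf, counit_tb, zero_smul, zero_add]
  simp [tb]

theorem ιInv_one : TensorAlgebra.ιInv (1 : T P) = 0 := by
  let _i1 : Module ℂᵐᵒᵖ (V P) := Module.compHom _ ((RingHom.id ℂ).fromOpposite mul_comm)
  have _i2 : IsCentralScalar ℂ (V P) := ⟨fun r m => rfl⟩
  have h : ∀ y : T P, TensorAlgebra.ιInv y = (TensorAlgebra.toTrivSqZeroExt y).snd := fun y => rfl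
  rw [h, map_one, TrivSqZeroExt.snd_one]

theorem pairOne_step (f : Module.Dual ℂ (V P)) (i : ι) (d : T P) :
    pairOne P f (tb P i * d) = counit P d * f (br P i) := by
  simp [pairOne, ιInv_mul]

/-- The counit law `x₍₁₎ ε(x₍₂₎) = x`. -/
theorem counit_right (x : T P) :
    (TensorProduct.rid ℂ (T P)) (LinearMap.lTensor (T P) (counit P).toLinearMap (coprod P x)) =
      x := by
  have hstep : ∀ i (z : T P ⊗[ℂ] T P),
      (TensorProduct.rid ℂ (T P)) (LinearMap.lTensor (T P) (counit P).toLinearMap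
        (coprodStep P i z)) =
      tb P i * (TensorProduct.rid ℂ (T P)) (LinearMap.lTensor (T P) (counit P).toLinearMap z) := by
    intro i z
    induction z using TensorProduct.induction_on with
    | zero => simp
    | tmul c d => simp
    | add a b ha hb => simp only [map_add, ha, hb, mul_add]
  refine T_induction P (C := fun x => (TensorProduct.rid ℂ (T P))
    (LinearMap.lTensor (T P) (counit P).toLinearMap (coprod P x)) = x) ?_ ?_ ?_ ?_ x
  · simp
  · intro x y hx hy; simp only [map_add, hx, hy]
  · intro a x hx; simp only [map_smul, hx]
  · intro i x hx; rw [coprod_step, hstep, hx]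

theorem D_one (f : Module.Dual ℂ (V P)) : D P f 1 = 0 := by
  simp [D, pairOne, ιInv_one]

theorem D_step (f : Module.Dual ℂ (V P)) (i : ι) (x : T P) :
    D P f (tb P i * x) = tb P i * D P f x + f (br P i) • tAct P (s P i) x := by
  have hstep : ∀ (z : T P ⊗[ℂ] T P),
      (TensorProduct.rid ℂ (T P)) (LinearMap.lTensor (T P) (pairOne P f) (coprodStep P i z)) =
      tb P i * (TensorProduct.rid ℂ (T P)) (LinearMap.lTensor (T P) (pairOne P f) z) +
      f (br P i) • tAct P (s P i) ((TensorProduct.rid ℂ (T P))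
        (LinearMap.lTensor (T P) (counit P).toLinearMap z)) := by
    intro z
    induction z using TensorProduct.induction_on with
    | zero => simp
    | tmul c d => simp [pairOne_step, smul_smul, mul_comm]
    | add a b ha hb => simp only [map_add, ha, hb, mul_add, smul_add]; abel
  change (TensorProduct.rid ℂ (T P)) (LinearMap.lTensor (T P) (pairOne P f)
    (coprod P (tb P i * x))) = _
  rw [coprod_step, hstep, counit_right]
  rfl

/-- `D_α`, the map `x ↦ x₍₁₎ ⟨[α], x₍₂₎⟩`. -/
def DT (i : ι) : T P →ₗ[ℂ] T P := D P (co P i)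

theorem DT_one (i : ι) : DT P i 1 = 0 := D_one P _

theorem DT_step (i j : ι) (x : T P) :
    DT P i (tb P j * x) = tb P j * DT P i x + pr P i j • tAct P (s P i) x := by
  rw [DT, D_step, co_br]
  by_cases h : pr P i j = 0
  · rw [h, zero_smul, zero_smul]
  · rw [s_eq_of_pr_ne_zero P h]

theorem DT_tb (i j : ι) : DT P i (tb P j) = pr P i j • 1 := by
  have := DT_step P i j 1
  simpa [DT_one] using this

theorem DT_mul (i : ι) (x y : T P) :
    DT P i (x * y) = x * DT P i y + DT P i x * tAct P (s P i) y := by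
  refine T_induction P (C := fun x => DT P i (x * y) = x * DT P i y + DT P i x *
    tAct P (s P i) y) ?_ ?_ ?_ ?_ x
  · simp [DT_one]
  · intro x x' hx hx'; simp only [add_mul, map_add, hx, hx']; abel
  · intro a x hx; simp only [smul_mul_assoc, map_smul, hx, smul_add]
  · intro j x hx
    rw [mul_assoc, DT_step, DT_step, hx, map_mul]
    simp only [mul_add, add_mul, smul_mul_assoc, mul_assoc]
    abel

theorem DT_act (w : P.weylGroup) (i : ι) (x : T P) :
    tAct P w (DT P i x) = DT P (w • i) (tAct P w x) := by
  refine T_induction P (C := fun x => tAct P w (DT P i x) = DT P (w • i) (tAct P w x))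
    ?_ ?_ ?_ ?_ x
  · simp [DT_one]
  · intro x x' hx hx'; simp only [map_add, hx, hx']
  · intro a x hx; simp only [map_smul, hx]
  · intro j x hx
    rw [map_mul (tAct P w), DT_step, tAct_tb, DT_step, pr_smul, ← hx, map_add, map_mul, tAct_tb,
      map_smul,
      ← tAct_mul, ← tAct_mul, s_smul]
    simp

theorem compT_act (w g : P.weylGroup) (x : T P) :
    tAct P w (compT P g x) = compT P (w * g * w⁻¹) (tAct P w x) := by
  suffices h : ∀ g, tAct P w (compT P g x) = compT P (w * g * w⁻¹) (tAct P w x) from h g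
  refine T_induction P (C := fun x => ∀ g, tAct P w (compT P g x) =
    compT P (w * g * w⁻¹) (tAct P w x)) ?_ ?_ ?_ ?_ x
  · intro g
    classical
    rw [map_one (tAct P w), compT_one, compT_one]
    by_cases h : g = 1
    · simp [h]
    · have h' : ¬ w * g * w⁻¹ = 1 := by
        rwa [conj_eq_one_iff]
      simp [h]
  · intro x x' hx hx' g; simp only [map_add, hx, hx']
  · intro a x hx g; simp only [map_smul, hx]
  · intro j x hx g
    rw [map_mul (tAct P w), compT_step, tAct_tb, compT_step, map_mul, hx, tAct_tb, s_smul]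
    congr 3
    group

theorem DT_comp (i : ι) (g : P.weylGroup) (x : T P) :
    DT P i (compT P g x) = compT P (g * s P i) (DT P i x) := by
  suffices h : ∀ g, DT P i (compT P g x) = compT P (g * s P i) (DT P i x) from h g
  refine T_induction P (C := fun x => ∀ g, DT P i (compT P g x) =
    compT P (g * s P i) (DT P i x)) ?_ ?_ ?_ ?_ x
  · intro g
    classical
    rw [compT_one, DT_one, map_zero]
    split_ifs <;> simp [DT_one]
  · intro x x' hx hx' g; simp only [map_add, hx, hx']
  · intro a x hx g; simp only [map_smul, hx]
  · intro j x hx g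
    rw [compT_step, DT_step, DT_step, hx, map_add, compT_step, map_smul, compT_act, mul_assoc]
    congr 1
    by_cases h : pr P i j = 0
    · rw [h, zero_smul, zero_smul]
    · rw [s_eq_of_pr_ne_zero P h, s_inv, ← mul_assoc, s_mul_self, one_mul]

theorem counit_act (w : P.weylGroup) (x : T P) : counit P (tAct P w x) = counit P x := by
  refine T_induction P (C := fun x => counit P (tAct P w x) = counit P x) ?_ ?_ ?_ ?_ x
  · simp
  · intro x x' hx hx'; simp only [map_add, hx, hx']
  · intro a x hx; simp only [map_smul, hx]
  · intro j x hx; simp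

theorem counit_comp (g : P.weylGroup) (x : T P) (hx : counit P x = 0) :
    counit P (compT P g x) = 0 := by
  classical
  have : ∀ g, counit P (compT P g x) = if g = 1 then counit P x else 0 := by
    refine T_induction P (C := fun x => ∀ g, counit P (compT P g x) =
      if g = 1 then counit P x else 0) ?_ ?_ ?_ ?_ x
    · intro g; rw [compT_one]; split_ifs <;> simp
    · intro x x' hx hx' g; simp only [map_add, hx, hx']; split_ifs <;> simp
    · intro a x hx g; simp only [map_smul, hx]; split_ifs <;> simp
    · intro j x hx g; rw [compT_step]; simp
  rw [this, hx]
  simp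

/-! ### The kernel of the pairing -/

/-- The subspace `I(V)`: the kernel of the duality pairing on the side of `T(V)`. -/
def ker : Submodule ℂ (T P) where
  carrier := {x | ∀ ξ : TensorAlgebra ℂ (Module.Dual ℂ (V P)), pairing P ξ x = 0}
  add_mem' := fun hx hy ξ => by rw [map_add, hx ξ, hy ξ, add_zero]
  zero_mem' := fun ξ => map_zero _
  smul_mem' := fun a x hx ξ => by rw [map_smul, hx ξ, smul_zero]

theorem mem_ker {x : T P} : x ∈ ker P ↔
    ∀ ξ : TensorAlgebra ℂ (Module.Dual ℂ (V P)), pairing P ξ x = 0 := Iff.rfl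

theorem counit_of_mem_ker {x : T P} (hx : x ∈ ker P) : counit P x = 0 := by
  rw [← pairing_one]
  exact hx 1

theorem DT_mem_ker (i : ι) {x : T P} (hx : x ∈ ker P) : DT P i x ∈ ker P := by
  intro ξ
  rw [DT, ← pairing_step]
  exact hx _

theorem D_eq_sum [Finite ι] (S : Submodule ℂ (T P)) (hD : ∀ i, ∀ x ∈ S, DT P i x ∈ S)
    (f : Module.Dual ℂ (V P)) (x : T P) (hx : x ∈ S) : D P f x ∈ S := by
  have := Fintype.ofFinite ι
  have h : ∀ z : T P ⊗[ℂ] T P, (TensorProduct.rid ℂ (T P)) (LinearMap.lTensor (T P)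
      (pairOne P f) z) = ∑ i, ((1 / 2 : ℂ) * f (br P i)) • (TensorProduct.rid ℂ (T P))
        (LinearMap.lTensor (T P) (pairOne P (co P i)) z) := by
    intro z
    induction z using TensorProduct.induction_on with
    | zero => simp
    | tmul c d =>
      have h1 := LinearMap.congr_fun (dual_eq_sum P f) (TensorAlgebra.ιInv d)
      simp only [LinearMap.lTensor_tmul, TensorProduct.rid_tmul, pairOne, LinearMap.comp_apply,
        smul_smul, ← Finset.sum_smul]
      rw [h1]
      simp
    | add a b ha hb => simp only [map_add, ha, hb, smul_add, Finset.sum_add_distrib]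
  have h2 : D P f x = ∑ i, ((1 / 2 : ℂ) * f (br P i)) • DT P i x := h (coprod P x)
  rw [h2]
  exact Submodule.sum_mem _ fun i _ => Submodule.smul_mem _ _ (hD i x hx)

/-- A subspace that is killed by the counit and stable under all `D_α` lies in the kernel. -/
theorem le_ker [Finite ι] (S : Submodule ℂ (T P)) (hε : ∀ x ∈ S, counit P x = 0)
    (hD : ∀ i, ∀ x ∈ S, DT P i x ∈ S) : S ≤ ker P := by
  intro x hx ξ
  have key : ∀ ξ η : TensorAlgebra ℂ (Module.Dual ℂ (V P)),
      (∀ x ∈ S, pairing P η x = 0) → ∀ x ∈ S, pairing P (ξ * η) x = 0 := by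
    intro ξ
    induction ξ using TensorAlgebra.induction with
    | algebraMap r =>
      intro η hη x hx
      rw [← Algebra.smul_def, map_smul, LinearMap.smul_apply, hη x hx, smul_zero]
    | ι f =>
      intro η hη x hx
      rw [pairing_step]
      exact hη _ (D_eq_sum P S hD f x hx)
    | mul a b ha hb => intro η hη x hx; rw [mul_assoc]; exact ha _ (hb _ hη) x hx
    | add a b ha hb =>
      intro η hη x hx
      rw [add_mul, map_add, LinearMap.add_apply, ha _ hη x hx, hb _ hη x hx, add_zero]
  have := key ξ 1 (fun x hx => by rw [pairing_one]; exact hε x hx) x hx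
  rwa [mul_one] at this

theorem act_mem_ker [Finite ι] (w : P.weylGroup) {x : T P} (hx : x ∈ ker P) :
    tAct P w x ∈ ker P := by
  have hmem : ∀ y : T P, y ∈ (ker P).comap (tAct P w⁻¹).toLinearMap ↔ tAct P w⁻¹ y ∈ ker P :=
    fun y => Submodule.mem_comap
  have h : (ker P).comap (tAct P w⁻¹).toLinearMap ≤ ker P := by
    apply le_ker P
    · intro y hy
      rw [hmem] at hy
      rw [← counit_act P w⁻¹]
      exact counit_of_mem_ker P hy
    · intro i y hy
      rw [hmem] at hy ⊢
      rw [DT_act]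
      exact DT_mem_ker P _ hy
  apply h
  rw [hmem, ← tAct_mul, inv_mul_cancel, tAct_one]
  exact hx

theorem comp_mem_ker [Finite ι] (g : P.weylGroup) {x : T P} (hx : x ∈ ker P) :
    compT P g x ∈ ker P := by
  have h := le_ker P (Submodule.span ℂ {y | ∃ g, ∃ z ∈ ker P, compT P g z = y})
    (fun y hy => by
      induction hy using Submodule.span_induction with
      | mem y hy =>
        obtain ⟨g, z, hz, rfl⟩ := hy
        exact counit_comp P g z (counit_of_mem_ker P hz)
      | zero => simp
      | add a b _ _ ha hb => rw [map_add, ha, hb, add_zero]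
      | smul a y _ hy => rw [map_smul, hy, smul_zero])
    (fun i y hy => by
      induction hy using Submodule.span_induction with
      | mem y hy =>
        obtain ⟨g, z, hz, rfl⟩ := hy
        rw [DT_comp]
        exact Submodule.subset_span ⟨_, _, DT_mem_ker P i hz, rfl⟩
      | zero => simp
      | add a b _ _ ha hb => rw [map_add]; exact add_mem ha hb
      | smul a y _ hy => rw [map_smul]; exact Submodule.smul_mem _ _ hy)
  exact h (Submodule.subset_span ⟨g, x, hx, rfl⟩)

theorem mul_mem_ker_left [Finite ι] (y : T P) {x : T P} (hx : x ∈ ker P) : y * x ∈ ker P := by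
  have h := le_ker P (Submodule.span ℂ {y | ∃ a, ∃ z ∈ ker P, a * z = y})
    (fun y hy => by
      induction hy using Submodule.span_induction with
      | mem y hy =>
        obtain ⟨a, z, hz, rfl⟩ := hy
        rw [map_mul, counit_of_mem_ker P hz, mul_zero]
      | zero => simp
      | add a b _ _ ha hb => rw [map_add, ha, hb, add_zero]
      | smul a y _ hy => rw [map_smul, hy, smul_zero])
    (fun i y hy => by
      induction hy using Submodule.span_induction with
      | mem y hy =>
        obtain ⟨a, z, hz, rfl⟩ := hy
        rw [DT_mul]
        exact add_mem (Submodule.subset_span ⟨_, _, DT_mem_ker P i hz, rfl⟩)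
          (Submodule.subset_span ⟨_, _, act_mem_ker P _ hz, rfl⟩)
      | zero => simp
      | add a b _ _ ha hb => rw [map_add]; exact add_mem ha hb
      | smul a y _ hy => rw [map_smul]; exact Submodule.smul_mem _ _ hy)
  exact h (Submodule.subset_span ⟨y, x, hx, rfl⟩)

theorem mul_mem_ker_right [Finite ι] (y : T P) {x : T P} (hx : x ∈ ker P) : x * y ∈ ker P := by
  have h := le_ker P (Submodule.span ℂ {y | ∃ a, ∃ z ∈ ker P, z * a = y})
    (fun y hy => by
      induction hy using Submodule.span_induction with
      | mem y hy =>
        obtain ⟨a, z, hz, rfl⟩ := hy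
        rw [map_mul, counit_of_mem_ker P hz, zero_mul]
      | zero => simp
      | add a b _ _ ha hb => rw [map_add, ha, hb, add_zero]
      | smul a y _ hy => rw [map_smul, hy, smul_zero])
    (fun i y hy => by
      induction hy using Submodule.span_induction with
      | mem y hy =>
        obtain ⟨a, z, hz, rfl⟩ := hy
        rw [DT_mul]
        exact add_mem (Submodule.subset_span ⟨_, _, hz, rfl⟩)
          (Submodule.subset_span ⟨_, _, DT_mem_ker P i hz, rfl⟩)
      | zero => simp
      | add a b _ _ ha hb => rw [map_add]; exact add_mem ha hb
      | smul a y _ hy => rw [map_smul]; exact Submodule.smul_mem _ _ hy)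
  exact h (Submodule.subset_span ⟨y, x, hx, rfl⟩)

/-- The ideal `I(V)` of `T(V)`. -/
def nicholsIdeal [Finite ι] : Ideal (T P) where
  carrier := ker P
  add_mem' := (ker P).add_mem
  zero_mem' := (ker P).zero_mem
  smul_mem' := fun y _ hx => mul_mem_ker_left P y hx

instance [Finite ι] : (nicholsIdeal P).IsTwoSided where
  mul_mem_of_left := fun b ha => mul_mem_ker_right P b ha

/-! ### The Nichols algebra -/

/-- The Nichols algebra `𝓑(V) = T(V) / I(V)`. It is also used as `𝓑(V*)`: the `W`-invariant
pairing with `⟨[α], [β]⟩ = δ_{α,β}` for positive roots `α`, `β` identifies `V*` with `V`, as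
braided vector spaces, and so `𝓑(V*)` with `𝓑(V)`. -/
def B [Finite ι] : Type _ := T P ⧸ nicholsIdeal P

instance [Finite ι] : Ring (B P) := inferInstanceAs (Ring (T P ⧸ nicholsIdeal P))

instance [Finite ι] : Algebra ℂ (B P) := inferInstanceAs (Algebra ℂ (T P ⧸ nicholsIdeal P))

variable [Finite ι]

/-- The quotient map `T(V) → 𝓑(V)`. -/
def mkB : T P →ₐ[ℂ] B P := Ideal.Quotient.mkₐ ℂ (nicholsIdeal P)

theorem mkB_surjective : Function.Surjective (mkB P) := Ideal.Quotient.mkₐ_surjective _ _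

theorem mkB_eq_zero {x : T P} : mkB P x = 0 ↔ x ∈ ker P :=
  Ideal.Quotient.eq_zero_iff_mem


/-- Factor a linear map through a surjective linear map. -/
def factor {E F G : Type*} [AddCommGroup E] [Module ℂ E] [AddCommGroup F] [Module ℂ F]
    [AddCommGroup G] [Module ℂ G] (p : E →ₗ[ℂ] F) (hp : Function.Surjective p) (f : E →ₗ[ℂ] G)
    (h : ∀ x, p x = 0 → f x = 0) : F →ₗ[ℂ] G :=
  (LinearMap.ker p).liftQ f (fun _ hx => h _ hx) ∘ₗ
    (p.quotKerEquivOfSurjective hp).symm.toLinearMap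

theorem factor_apply {E F G : Type*} [AddCommGroup E] [Module ℂ E] [AddCommGroup F] [Module ℂ F]
    [AddCommGroup G] [Module ℂ G] (p : E →ₗ[ℂ] F) (hp : Function.Surjective p) (f : E →ₗ[ℂ] G)
    (h : ∀ x, p x = 0 → f x = 0) (x : E) : factor p hp f h (p x) = f x := by
  have : (p.quotKerEquivOfSurjective hp).symm (p x) = Submodule.Quotient.mk x := by
    rw [LinearEquiv.symm_apply_eq]
    rfl
  simp only [factor, LinearMap.comp_apply, LinearEquiv.coe_coe, this]
  exact Submodule.liftQ_apply _ _ _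

/-- The generator `[α]` of `𝓑(V)`. -/
def xb (i : ι) : B P := mkB P (tb P i)

theorem xb_neg (i : ι) : xb P (neg P i) = -xb P i := by
  rw [xb, tb_neg, map_neg]; rfl

theorem B_induction {C : B P → Prop} (h1 : C 1) (hadd : ∀ x y, C x → C y → C (x + y))
    (hsmul : ∀ (a : ℂ) x, C x → C (a • x)) (hmul : ∀ i x, C x → C (xb P i * x)) (x : B P) :
    C x := by
  obtain ⟨y, rfl⟩ := mkB_surjective P x
  refine T_induction P (C := fun y => C (mkB P y)) ?_ ?_ ?_ ?_ y
  · rw [map_one]; exact h1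
  · intro x y hx hy; rw [map_add]; exact hadd _ _ hx hy
  · intro a x hx; rw [map_smul]; exact hsmul _ _ hx
  · intro i x hx; rw [map_mul]; exact hmul _ _ hx

/-- The action of `W` on `𝓑(V)` by algebra automorphisms. -/
def act (w : P.weylGroup) : B P →ₐ[ℂ] B P :=
  Ideal.Quotient.liftₐ (nicholsIdeal P) ((mkB P).comp (tAct P w))
    (fun _ hx => (mkB_eq_zero P).2 (act_mem_ker P w hx))

theorem act_mk (w : P.weylGroup) (x : T P) : act P w (mkB P x) = mkB P (tAct P w x) := rfl

@[simp] theorem act_xb (w : P.weylGroup) (i : ι) : act P w (xb P i) = xb P (w • i) := by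
  rw [xb, act_mk, tAct_tb]; rfl

theorem act_mul (w w' : P.weylGroup) (x : B P) : act P (w * w') x = act P w (act P w' x) := by
  obtain ⟨y, rfl⟩ := mkB_surjective P x
  rw [act_mk, act_mk, act_mk, tAct_mul]

theorem act_one (x : B P) : act P 1 x = x := by
  obtain ⟨y, rfl⟩ := mkB_surjective P x
  rw [act_mk, tAct_one]

theorem act_inv_act (w : P.weylGroup) (x : B P) : act P w⁻¹ (act P w x) = x := by
  rw [← act_mul, inv_mul_cancel, act_one]

/-- The `W`-grading of `𝓑(V)`, written as `x ↦ ∑_g x_g g` with `x_g` the component of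
degree `g`. -/
def coact : B P →ₐ[ℂ] MonoidAlgebra (B P) P.weylGroup :=
  Ideal.Quotient.liftₐ (nicholsIdeal P)
    ((MonoidAlgebra.mapAlgHom P.weylGroup (mkB P)).comp (coactT P))
    (fun x hx => by
      ext g
      exact (mkB_eq_zero P).2 (comp_mem_ker P g hx))

/-- The component of degree `g` of an element of `𝓑(V)`. -/
def comp (g : P.weylGroup) : B P →ₗ[ℂ] B P :=
  Finsupp.lapply g ∘ₗ (MonoidAlgebra.coeffLinearEquiv ℂ).toLinearMap ∘ₗ (coact P).toLinearMap

theorem comp_apply (g : P.weylGroup) (x : B P) : comp P g x = (coact P x).coeff g := rfl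

theorem comp_mk (g : P.weylGroup) (x : T P) : comp P g (mkB P x) = mkB P (compT P g x) := rfl

theorem coact_xb (i : ι) : coact P (xb P i) = MonoidAlgebra.single (s P i) (xb P i) := by
  have : coact P (xb P i) = MonoidAlgebra.mapAlgHom P.weylGroup (mkB P) (coactT P (tb P i)) := rfl
  rw [this, coactT, liftT_tb]
  ext g
  change mkB P ((MonoidAlgebra.single (s P i) (tb P i)).coeff g) = _
  classical
  rw [MonoidAlgebra.coeff_single, MonoidAlgebra.coeff_single, Finsupp.single_apply,
    Finsupp.single_apply]
  split_ifs
  · rfl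
  · exact map_zero _

/-- The map `x ↦ x₍₁₎ ⟨[α], x₍₂₎⟩` on `𝓑(V)`. -/
def DB (i : ι) : B P →ₗ[ℂ] B P :=
  factor (mkB P).toLinearMap (mkB_surjective P) ((mkB P).toLinearMap ∘ₗ DT P i)
    (fun _ hx => (mkB_eq_zero P).2 (DT_mem_ker P i ((mkB_eq_zero P).1 hx)))

theorem DB_mk (i : ι) (x : T P) : DB P i (mkB P x) = mkB P (DT P i x) :=
  factor_apply (mkB P).toLinearMap (mkB_surjective P) _ _ x

theorem DB_one (i : ι) : DB P i 1 = 0 := by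
  rw [← map_one (mkB P), DB_mk, DT_one, map_zero]

theorem DB_xb (i j : ι) : DB P i (xb P j) = pr P i j • 1 := by
  rw [xb, DB_mk, DT_tb, map_smul, map_one]

theorem DB_mul (i : ι) (x y : B P) :
    DB P i (x * y) = x * DB P i y + DB P i x * act P (s P i) y := by
  obtain ⟨x, rfl⟩ := mkB_surjective P x
  obtain ⟨y, rfl⟩ := mkB_surjective P y
  rw [← map_mul, DB_mk, DT_mul, DB_mk, DB_mk, act_mk, map_add, map_mul, map_mul]

theorem DB_act (w : P.weylGroup) (i : ι) (x : B P) :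
    act P w (DB P i x) = DB P (w • i) (act P w x) := by
  obtain ⟨x, rfl⟩ := mkB_surjective P x
  rw [DB_mk, act_mk, act_mk, DB_mk, DT_act]

/-- The twisted derivation `D̄_α` of `𝓑(V)`. It is characterized by `dbar_one`, `dbar_xb` and
`dbar_mul` below. -/
def dbar (i : ι) : B P →ₗ[ℂ] B P := (act P (s P i)).toLinearMap ∘ₗ DB P i

theorem dbar_apply (i : ι) (x : B P) : dbar P i x = act P (s P i) (DB P i x) := rfl

theorem dbar_one (i : ι) : dbar P i 1 = 0 := by
  rw [dbar_apply, DB_one, map_zero]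

theorem dbar_xb (i j : ι) : dbar P i (xb P j) = pr P i j • 1 := by
  rw [dbar_apply, DB_xb, map_smul, map_one]

/-- The twisted Leibniz rule. -/
theorem dbar_mul (i : ι) (x y : B P) :
    dbar P i (x * y) = dbar P i x * y + act P (s P i) x * dbar P i y := by
  rw [dbar_apply, DB_mul, map_add, map_mul, map_mul, ← act_mul, s_mul_self, act_one, add_comm]
  rfl

theorem dbar_neg (i : ι) : dbar P (neg P i) = -dbar P i := by
  ext1 x
  refine B_induction P (C := fun x => dbar P (neg P i) x = -dbar P i x) ?_ ?_ ?_ ?_ x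
  · rw [dbar_one, dbar_one, _root_.neg_zero]
  · intro x y hx hy; rw [map_add, map_add, hx, hy, neg_add]
  · intro a x hx; rw [map_smul, map_smul, hx, _root_.smul_neg]
  · intro j x hx
    rw [dbar_mul, dbar_mul, hx, s_neg, dbar_xb, dbar_xb, pr_comm, pr_neg_right, pr_comm]
    simp only [neg_smul, neg_mul, mul_neg, neg_add]

/-! ### Homogeneous elements -/

/-- Elements that are homogeneous of degree `g`. -/
def Homog (g : P.weylGroup) (x : B P) : Prop := coact P x = MonoidAlgebra.single g x

theorem homog_of_comp {g : P.weylGroup} {x : B P}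
    (h : ∀ h, h ≠ g → comp P h x = 0) (h' : comp P g x = x) : Homog P g x := by
  unfold Homog
  ext k
  classical
  rw [MonoidAlgebra.coeff_single, Finsupp.single_apply, ← comp_apply]
  split_ifs with hk
  · rw [← hk]; exact h'
  · exact h k (Ne.symm hk)

theorem Homog.comp_eq {g : P.weylGroup} {x : B P} (h : Homog P g x) : comp P g x = x := by
  rw [comp_apply, h, MonoidAlgebra.coeff_single, Finsupp.single_eq_same]

theorem Homog.comp_ne {g k : P.weylGroup} {x : B P} (h : Homog P g x) (hk : k ≠ g) :
    comp P k x = 0 := by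
  rw [comp_apply, h, MonoidAlgebra.coeff_single, Finsupp.single_eq_of_ne hk]

theorem homog_one : Homog P 1 1 := by
  unfold Homog
  rw [map_one, MonoidAlgebra.one_def]

theorem homog_xb (i : ι) : Homog P (s P i) (xb P i) := coact_xb P i

theorem Homog.mul {g h : P.weylGroup} {x y : B P} (hx : Homog P g x) (hy : Homog P h y) :
    Homog P (g * h) (x * y) := by
  unfold Homog at *
  rw [map_mul, hx, hy, MonoidAlgebra.single_mul_single]

theorem comp_act (w g : P.weylGroup) (x : B P) :
    act P w (comp P g x) = comp P (w * g * w⁻¹) (act P w x) := by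
  obtain ⟨x, rfl⟩ := mkB_surjective P x
  rw [comp_mk, act_mk, act_mk, comp_mk, compT_act]

theorem comp_DB (i : ι) (g : P.weylGroup) (x : B P) :
    DB P i (comp P g x) = comp P (g * s P i) (DB P i x) := by
  obtain ⟨x, rfl⟩ := mkB_surjective P x
  rw [comp_mk, DB_mk, DB_mk, comp_mk, DT_comp]

theorem Homog.act {g : P.weylGroup} {x : B P} (hx : Homog P g x) (w : P.weylGroup) :
    Homog P (w * g * w⁻¹) (act P w x) := by
  apply homog_of_comp
  · intro k hk
    have h := comp_act P w (w⁻¹ * k * w) x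
    rw [hx.comp_ne, map_zero] at h
    · rw [h]; congr 2; group
    · rintro rfl
      exact hk (by group)
  · rw [← comp_act, hx.comp_eq]

theorem Homog.DB {g : P.weylGroup} {x : B P} (hx : Homog P g x) (i : ι) :
    Homog P (g * s P i) (DB P i x) := by
  apply homog_of_comp
  · intro k hk
    have h := comp_DB P i (k * (s P i)⁻¹) x
    rw [hx.comp_ne, map_zero] at h
    · rw [h]; congr 2; group
    · rintro rfl
      exact hk (by group)
  · rw [← comp_DB, hx.comp_eq]

/-- A linear statement on `𝓑(V)` may be checked on homogeneous elements. -/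
theorem homog_induction {C : B P → Prop} (hadd : ∀ x y, C x → C y → C (x + y))
    (hsmul : ∀ (a : ℂ) x, C x → C (a • x)) (hh : ∀ g x, Homog P g x → C x) (x : B P) : C x := by
  have h0 : C 0 := by simpa using hsmul 0 1 (hh 1 1 (homog_one P))
  have key : x ∈ Submodule.span ℂ {y | ∃ g, Homog P g y} := by
    refine B_induction P (C := fun x => x ∈ Submodule.span ℂ {y | ∃ g, Homog P g y})
      ?_ ?_ ?_ ?_ x
    · exact Submodule.subset_span ⟨1, homog_one P⟩
    · exact fun x y hx hy => add_mem hx hy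
    · exact fun a x hx => Submodule.smul_mem _ _ hx
    · intro i x hx
      induction hx using Submodule.span_induction with
      | mem y hy =>
        obtain ⟨g, hg⟩ := hy
        exact Submodule.subset_span ⟨_, (homog_xb P i).mul P hg⟩
      | zero => rw [mul_zero]; exact zero_mem _
      | add a b _ _ ha hb => rw [mul_add]; exact add_mem ha hb
      | smul a y _ hy => rw [mul_smul_comm]; exact Submodule.smul_mem _ _ hy
  induction key using Submodule.span_induction with
  | mem y hy => obtain ⟨g, hg⟩ := hy; exact hh g y hg
  | zero => exact h0
  | add a b _ _ ha hb => exact hadd _ _ ha hb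
  | smul a y _ hy => exact hsmul _ _ hy

/-- The sum `∑_g F_g(x_g)` over the homogeneous components `x_g` of `x`. -/
def sumComp {E : Type*} [AddCommMonoid E] [Module ℂ E] (F : P.weylGroup → B P →ₗ[ℂ] E) :
    B P →ₗ[ℂ] E :=
  Finsupp.lsum ℂ F ∘ₗ (MonoidAlgebra.coeffLinearEquiv ℂ).toLinearMap ∘ₗ (coact P).toLinearMap

theorem Homog.sumComp_eq {E : Type*} [AddCommMonoid E] [Module ℂ E] (F : P.weylGroup → B P →ₗ[ℂ] E)
    {g : P.weylGroup} {x : B P} (hx : Homog P g x) : sumComp P F x = F g x := by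
  have h : sumComp P F x = Finsupp.lsum ℂ F (coact P x).coeff := rfl
  rw [h, hx, MonoidAlgebra.coeff_single, Finsupp.lsum_single]

/-! ### The braiding and the modified product -/

/-- The braiding `ψ(x ⊗ y) = ∑_g g.y ⊗ x_g` of `𝓑(V)`. -/
def braidHom : B P ⊗[ℂ] B P →ₗ[ℂ] B P ⊗[ℂ] B P :=
  TensorProduct.lift (sumComp P fun g =>
    (LinearMap.compl₁₂ (TensorProduct.mk ℂ (B P) (B P)) (act P g).toLinearMap
      LinearMap.id).flip)

/-- The inverse braiding `ψ⁻¹(y ⊗ x) = ∑_g x_g ⊗ g⁻¹.y`. -/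
def braidInv : B P ⊗[ℂ] B P →ₗ[ℂ] B P ⊗[ℂ] B P :=
  TensorProduct.lift (sumComp P fun g =>
    LinearMap.compl₁₂ (TensorProduct.mk ℂ (B P) (B P)) LinearMap.id
      (act P g⁻¹).toLinearMap).flip

theorem braidHom_tmul {g : P.weylGroup} {x : B P} (hx : Homog P g x) (y : B P) :
    braidHom P (x ⊗ₜ y) = act P g y ⊗ₜ x := by
  simp only [braidHom, TensorProduct.lift.tmul, hx.sumComp_eq]
  rfl

theorem braidInv_tmul {g : P.weylGroup} {x : B P} (hx : Homog P g x) (y : B P) :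
    braidInv P (y ⊗ₜ x) = x ⊗ₜ act P g⁻¹ y := by
  simp only [braidInv, TensorProduct.lift.tmul, LinearMap.flip_apply, hx.sumComp_eq]
  rfl

/-- The braiding `ψ` of `𝓑(V)`, `ψ(x ⊗ y) = g.y ⊗ x` for `x` of degree `g`. -/
def braiding : B P ⊗[ℂ] B P ≃ₗ[ℂ] B P ⊗[ℂ] B P :=
  LinearEquiv.ofLinearMap (braidHom P) (braidInv P)
    (by
      apply TensorProduct.ext'
      intro y x
      refine homog_induction P (C := fun x => (braidHom P ∘ₗ braidInv P) (y ⊗ₜ x) =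
        LinearMap.id (y ⊗ₜ[ℂ] x)) ?_ ?_ ?_ x
      · intro a b ha hb; rw [TensorProduct.tmul_add, map_add, map_add, ha, hb]
      · intro a b hb; rw [TensorProduct.tmul_smul, map_smul, map_smul, hb]
      · intro g x hx
        rw [LinearMap.comp_apply, braidInv_tmul P hx, braidHom_tmul P hx, ← act_mul,
          mul_inv_cancel, act_one]
        rfl)
    (by
      apply TensorProduct.ext'
      intro x y
      refine homog_induction P (C := fun x => (braidInv P ∘ₗ braidHom P) (x ⊗ₜ y) =
        LinearMap.id (x ⊗ₜ[ℂ] y)) ?_ ?_ ?_ x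
      · intro a b ha hb; rw [TensorProduct.add_tmul, map_add, map_add, ha, hb]
      · intro a b hb; rw [← TensorProduct.smul_tmul', map_smul, map_smul, hb]
      · intro g x hx
        rw [LinearMap.comp_apply, braidHom_tmul P hx, braidInv_tmul P hx, act_inv_act]
        rfl)

/-- The modified product `a * b = m(ψ⁻¹(a ⊗ b))` on `𝓑(V)`. -/
def star (a b : B P) : B P :=
  LinearMap.mul' ℂ (B P) ((braiding P).symm (a ⊗ₜ b))

theorem star_homog {g : P.weylGroup} {b : B P} (hb : Homog P g b) (a : B P) :
    star P a b = b * act P g⁻¹ a := by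
  have : (braiding P).symm (a ⊗ₜ b) = braidInv P (a ⊗ₜ b) := rfl
  rw [star, this, braidInv_tmul P hb, LinearMap.mul'_apply]

theorem star_add (a b c : B P) : star P a (b + c) = star P a b + star P a c := by
  simp only [star, TensorProduct.tmul_add, map_add]

theorem add_star (a b c : B P) : star P (a + b) c = star P a c + star P b c := by
  simp only [star, TensorProduct.add_tmul, map_add]

theorem star_smul (r : ℂ) (a b : B P) : star P a (r • b) = r • star P a b := by
  simp only [star, TensorProduct.tmul_smul, map_smul]

theorem smul_star (r : ℂ) (a b : B P) : star P (r • a) b = r • star P a b := by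
  simp only [star, ← TensorProduct.smul_tmul', map_smul]

theorem Homog.star_mem {g h : P.weylGroup} {a b : B P} (ha : Homog P g a) (hb : Homog P h b) :
    Homog P (g * h) (star P a b) := by
  rw [star_homog P hb]
  have := hb.mul P (ha.act P h⁻¹)
  convert this using 1
  group

theorem star_assoc (a b c : B P) : star P (star P a b) c = star P a (star P b c) := by
  refine homog_induction P (C := fun b => star P (star P a b) c = star P a (star P b c))
    ?_ ?_ ?_ b
  · intro x y hx hy; simp only [star_add, add_star, hx, hy]
  · intro r x hx; simp only [star_smul, smul_star, hx]
  · intro g b hb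
    refine homog_induction P (C := fun c => star P (star P a b) c = star P a (star P b c))
      ?_ ?_ ?_ c
    · intro x y hx hy; simp only [star_add, hx, hy]
    · intro r x hx; simp only [star_smul, hx]
    · intro h c hc
      rw [star_homog P hc, star_homog P hb, star_homog P (hb.star_mem P hc), star_homog P hc,
        map_mul, mul_inv_rev, act_mul, mul_assoc]

theorem one_star (b : B P) : star P 1 b = b := by
  refine homog_induction P (C := fun b => star P 1 b = b) ?_ ?_ ?_ b
  · intro x y hx hy; rw [star_add, hx, hy]
  · intro r x hx; rw [star_smul, hx]
  · intro g b hb; rw [star_homog P hb, map_one, mul_one]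

theorem star_one (a : B P) : star P a 1 = a := by
  rw [star_homog P (homog_one P), one_mul, inv_one, act_one]

/-- The algebra `𝓑̃(V)`: the space `𝓑(V)` with the modified product. -/
def Bt : Type _ := B P

/-- The identity of `𝓑(V)`, as a map to `𝓑̃(V)`. -/
def toBt : B P → Bt P := id

/-- The identity of `𝓑(V)`, as a map from `𝓑̃(V)`. -/
def ofBt : Bt P → B P := id

instance : AddCommGroup (Bt P) := inferInstanceAs (AddCommGroup (B P))

instance : Module ℂ (Bt P) := inferInstanceAs (Module ℂ (B P))

instance : Ring (Bt P) where
  __ := (inferInstance : AddCommGroup (Bt P))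
  mul a b := toBt P (star P (ofBt P a) (ofBt P b))
  one := toBt P 1
  left_distrib := star_add P
  right_distrib := add_star P
  zero_mul a := by
    have := smul_star P 0 0 (ofBt P a)
    rwa [zero_smul, zero_smul] at this
  mul_zero a := by
    have := star_smul P 0 (ofBt P a) 0
    rwa [zero_smul, zero_smul] at this
  mul_assoc := star_assoc P
  one_mul := one_star P
  mul_one := star_one P

theorem mul_def (a b : Bt P) : a * b = toBt P (star P (ofBt P a) (ofBt P b)) := rfl

theorem one_def : (1 : Bt P) = toBt P 1 := rfl

instance : Algebra ℂ (Bt P) :=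
  Algebra.ofModule (fun r a b => smul_star P r a b) (fun r a b => star_smul P r a b)

/-- The generator `[α]` of `𝓑̃(V)`. -/
def yb (i : ι) : Bt P := toBt P (xb P i)

theorem yb_neg (i : ι) : yb P (neg P i) = -yb P i := xb_neg P i


/-! ### The algebra structure on `𝓑(V*) ⊗ 𝓑̃(V)` -/

/-- The algebra map `T(V) → 𝓑̃(V)` with `[α] ↦ [α]`. -/
def toTilde : T P →ₐ[ℂ] Bt P := liftT P (yb P) (yb_neg P)

theorem toTilde_step (i : ι) (x : T P) : toTilde P (tb P i * x) = yb P i * toTilde P x := by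
  rw [map_mul, toTilde, liftT_tb]

theorem mul_yb (a : B P) (i : ι) : toBt P a * yb P i = toBt P (xb P i * act P (s P i) a) := by
  have := star_homog P (homog_xb P i) a
  rw [s_inv] at this
  exact congrArg (toBt P) this

theorem toTilde_surjective : Function.Surjective (toTilde P) := by
  have key : ∀ x : T P, ∀ w : P.weylGroup, ∃ z, toTilde P z = toBt P (mkB P (tAct P w x)) := by
    intro x
    refine T_induction P (C := fun x => ∀ w : P.weylGroup, ∃ z, toTilde P z =
      toBt P (mkB P (tAct P w x))) ?_ ?_ ?_ ?_ x
    · intro w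
      exact ⟨1, by rw [map_one (tAct P w), map_one (mkB P), map_one]; rfl⟩
    · intro x y hx hy w
      obtain ⟨a, ha⟩ := hx w
      obtain ⟨b, hb⟩ := hy w
      exact ⟨a + b, by rw [map_add, ha, hb, map_add (tAct P w), map_add (mkB P)]; rfl⟩
    · intro r x hx w
      obtain ⟨a, ha⟩ := hx w
      exact ⟨r • a, by rw [map_smul, ha, map_smul (tAct P w), map_smul (mkB P)]; rfl⟩
    · intro i x hx w
      obtain ⟨a, ha⟩ := hx (s P (w • i) * w)
      refine ⟨a * tb P (w • i), ?_⟩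
      have h1 : toTilde P (tb P (w • i)) = yb P (w • i) := liftT_tb P _ _ _
      rw [map_mul, ha, h1, mul_yb, act_mk, ← tAct_mul, ← mul_assoc, s_mul_self, one_mul,
        map_mul (tAct P w), map_mul (mkB P), tAct_tb]
      rfl
  intro b
  obtain ⟨x, hx⟩ := mkB_surjective P (ofBt P b)
  obtain ⟨z, hz⟩ := key x 1
  refine ⟨z, ?_⟩
  rw [hz, tAct_one, hx]
  rfl

/-- The space `𝓑(V*) ⊗ 𝓑̃(V)`. -/
def H : Type _ := B P ⊗[ℂ] Bt P

instance : AddCommGroup (H P) := inferInstanceAs (AddCommGroup (B P ⊗[ℂ] Bt P))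

instance : Module ℂ (H P) := inferInstanceAs (Module ℂ (B P ⊗[ℂ] Bt P))

/-- The pure tensor `x ⊗ b`. -/
def tens (x : B P) (b : Bt P) : H P := x ⊗ₜ[ℂ] b

/-- The bilinear map `(x, b) ↦ x ⊗ b`. -/
def tensL : B P →ₗ[ℂ] Bt P →ₗ[ℂ] H P := TensorProduct.mk ℂ (B P) (Bt P)

theorem tensL_apply (x : B P) (b : Bt P) : tensL P x b = tens P x b := rfl

theorem tens_add_left (x y : B P) (b : Bt P) : tens P (x + y) b = tens P x b + tens P y b :=
  TensorProduct.add_tmul x y b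

theorem tens_smul_left (r : ℂ) (x : B P) (b : Bt P) : tens P (r • x) b = r • tens P x b := rfl

theorem tens_add_right (x : B P) (b c : Bt P) : tens P x (b + c) = tens P x b + tens P x c :=
  TensorProduct.tmul_add x b c

theorem tens_smul_right (r : ℂ) (x : B P) (b : Bt P) : tens P x (r • b) = r • tens P x b :=
  TensorProduct.tmul_smul r x b

theorem H_induction {C : H P → Prop} (htens : ∀ x b, C (tens P x b))
    (hadd : ∀ m m', C m → C m' → C (m + m')) (m : H P) : C m := by
  refine TensorProduct.induction_on (motive := C) m ?_ htens hadd
  have := htens 0 0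
  rwa [← zero_smul ℂ (0 : B P), tens_smul_left, zero_smul] at this

theorem H_ext {E : Type*} [AddCommGroup E] [Module ℂ E] {f g : H P →ₗ[ℂ] E}
    (h : ∀ x b, f (tens P x b) = g (tens P x b)) : f = g := by
  ext1 m
  exact H_induction P (C := fun m => f m = g m) h
    (fun m m' hm hm' => by rw [map_add, map_add, hm, hm']) m

/-- The map `u ⊗ v ↦ x u ⊗ v`. -/
def lam (x : B P) : Module.End ℂ (H P) :=
  (TensorProduct.map (LinearMap.mulLeft ℂ x) LinearMap.id : B P ⊗[ℂ] Bt P →ₗ[ℂ] B P ⊗[ℂ] Bt P)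

@[simp] theorem lam_tens (x u : B P) (v : Bt P) : lam P x (tens P u v) = tens P (x * u) v := rfl

/-- The map `u ⊗ v ↦ D̄_α(u) ⊗ v + s_α(u) ⊗ [α] * v`. -/
def opT (i : ι) : Module.End ℂ (H P) :=
  (TensorProduct.map (dbar P i) LinearMap.id +
    TensorProduct.map (act P (s P i)).toLinearMap (LinearMap.mulLeft ℂ (yb P i)) :
      B P ⊗[ℂ] Bt P →ₗ[ℂ] B P ⊗[ℂ] Bt P)

@[simp] theorem opT_tens (i : ι) (u : B P) (v : Bt P) : opT P i (tens P u v) =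
    tens P (dbar P i u) v + tens P (act P (s P i) u) (yb P i * v) := rfl

theorem opT_neg (i : ι) : opT P (neg P i) = -opT P i := by
  apply H_ext
  intro u v
  have h1 : dbar P (neg P i) u = (-1 : ℂ) • dbar P i u := by
    rw [dbar_neg, neg_one_smul]; rfl
  have h2 : yb P (neg P i) * v = (-1 : ℂ) • (yb P i * v) := by
    rw [yb_neg, neg_one_smul, neg_mul]
  rw [opT_tens, h1, h2, s_neg, tens_smul_left, tens_smul_right, ← smul_add, neg_one_smul]
  rfl

theorem lam_mul (x y : B P) (m : H P) : lam P (x * y) m = lam P x (lam P y m) := by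
  refine H_induction P (C := fun m => lam P (x * y) m = lam P x (lam P y m)) ?_ ?_ m
  · intro u v; simp [mul_assoc]
  · intro m m' hm hm'; rw [map_add, map_add, map_add, hm, hm']

theorem lam_one (m : H P) : lam P 1 m = m := by
  refine H_induction P (C := fun m => lam P 1 m = m) ?_ ?_ m
  · intro u v; simp
  · intro m m' hm hm'; rw [map_add, hm, hm']

/-- The map `x ↦ (u ⊗ v ↦ x u ⊗ v)`. -/
def lamL : B P →ₗ[ℂ] Module.End ℂ (H P) where
  toFun := lam P
  map_add' x y := by
    apply H_ext
    intro u v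
    rw [lam_tens, add_mul, tens_add_left]
    rfl
  map_smul' r x := by
    apply H_ext
    intro u v
    rw [lam_tens, smul_mul_assoc, tens_smul_left]
    rfl

theorem lamL_apply (x : B P) : lamL P x = lam P x := rfl

theorem opT_lam (i : ι) (x : B P) (m : H P) : opT P i (lam P x m) =
    lam P (dbar P i x) m + lam P (act P (s P i) x) (opT P i m) := by
  refine H_induction P (C := fun m => opT P i (lam P x m) =
    lam P (dbar P i x) m + lam P (act P (s P i) x) (opT P i m)) ?_ ?_ m
  · intro u v
    rw [lam_tens, opT_tens, dbar_mul, opT_tens, map_add, lam_tens, lam_tens, lam_tens,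
      tens_add_left, map_mul, add_assoc]
  · intro m m' hm hm'
    simp only [map_add, hm, hm']
    abel

/-- The algebra map from `T(V)` to operators with `[α] ↦ opT α`. -/
def opTilde : T P →ₐ[ℂ] Module.End ℂ (H P) := liftT P (opT P) (opT_neg P)

theorem opTilde_step (i : ι) (x : T P) (m : H P) :
    opTilde P (tb P i * x) m = opT P i (opTilde P x m) := by
  rw [map_mul, opTilde, liftT_tb]
  rfl

theorem opTilde_one_tens (r : T P) (v : Bt P) :
    opTilde P r (tens P 1 v) = tens P 1 (toTilde P r * v) := by
  refine T_induction P (C := fun r => opTilde P r (tens P 1 v) = tens P 1 (toTilde P r * v))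
    ?_ ?_ ?_ ?_ r
  · simp
  · intro x y hx hy
    rw [map_add, map_add, LinearMap.add_apply, hx, hy, add_mul, tens_add_right]
  · intro a x hx
    rw [map_smul, map_smul, LinearMap.smul_apply, hx, smul_mul_assoc, tens_smul_right]
  · intro i x hx
    rw [opTilde_step, hx, opT_tens, dbar_one, toTilde_step, map_one, mul_assoc,
      ← zero_smul ℂ (0 : B P), tens_smul_left, zero_smul, zero_add]

theorem Homog.yb_mul {g : P.weylGroup} {b : B P} (hb : Homog P g b) (i : ι) :
    yb P i * toBt P b = toBt P (b * xb P (g⁻¹ • i)) := by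
  have := star_homog P hb (xb P i)
  rw [act_xb] at this
  exact congrArg (toBt P) this

/-- The commutation of an element of `𝓑̃(V)` with a generator of `𝓑(V*)`. -/
def pull (j : ι) (E : B P →ₗ[ℂ] Bt P →ₗ[ℂ] H P) : B P →ₗ[ℂ] Bt P →ₗ[ℂ] H P :=
  sumComp P (fun g => (LinearMap.llcomp ℂ (Bt P) (H P) (H P) (lam P (xb P (g • j)))) ∘ₗ E) +
    E ∘ₗ DB P j

theorem pull_homog (j : ι) (E : B P →ₗ[ℂ] Bt P →ₗ[ℂ] H P) {g : P.weylGroup} {b : B P}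
    (hb : Homog P g b) (v : Bt P) :
    pull P j E b v = lam P (xb P (g • j)) (E b v) + E (DB P j b) v := by
  rw [pull, LinearMap.add_apply, hb.sumComp_eq]
  rfl

theorem pull_step (j i : ι) (E : B P →ₗ[ℂ] Bt P →ₗ[ℂ] H P)
    (hE : ∀ b v, opT P i (E b v) = E (ofBt P (yb P i * toBt P b)) v) (b : B P) (v : Bt P) :
    opT P i (pull P j E b v) = pull P j E (ofBt P (yb P i * toBt P b)) v := by
  refine homog_induction P (C := fun b => opT P i (pull P j E b v) =
    pull P j E (ofBt P (yb P i * toBt P b)) v) ?_ ?_ ?_ b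
  · intro x y hx hy
    have : ofBt P (yb P i * toBt P (x + y)) = ofBt P (yb P i * toBt P x) +
      ofBt P (yb P i * toBt P y) := star_add P _ _ _
    rw [this, map_add, map_add, LinearMap.add_apply, LinearMap.add_apply, map_add, hx, hy]
  · intro r x hx
    have : ofBt P (yb P i * toBt P (r • x)) = r • ofBt P (yb P i * toBt P x) :=
      star_smul P _ _ _
    rw [this, map_smul, map_smul, LinearMap.smul_apply, LinearMap.smul_apply, map_smul, hx]
  · intro g b hb
    have h1 : ofBt P (yb P i * toBt P b) = b * xb P (g⁻¹ • i) := by rw [hb.yb_mul]; rfl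
    have h2 : ofBt P (yb P i * toBt P (DB P j b)) = DB P j b * xb P ((g * s P j)⁻¹ • i) := by
      rw [(hb.DB P j).yb_mul]; rfl
    have h3 : Homog P (s P i * g) (b * xb P (g⁻¹ • i)) := by
      have := hb.mul P (homog_xb P (g⁻¹ • i))
      convert this using 1
      rw [s_smul]
      group
    have h4 : pr P i (g • j) = pr P j (g⁻¹ • i) := by
      rw [pr_comm, ← pr_smul P g⁻¹, inv_smul_smul]
    rw [pull_homog P j E hb, map_add, opT_lam, hE, hE, h1, h2, pull_homog P j E h3, dbar_xb,
      act_xb, DB_mul, DB_xb, act_xb, mul_inv_rev, s_inv, mul_smul, mul_smul, h4, map_add,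
      ← lamL_apply P (pr P j (g⁻¹ • i) • 1), map_smul, lamL_apply, LinearMap.smul_apply, lam_one,
      mul_smul_comm, mul_one, map_smul, LinearMap.add_apply, LinearMap.smul_apply]
    abel

theorem exists_op (u : T P) : ∃ E : B P →ₗ[ℂ] Bt P →ₗ[ℂ] H P, ∀ r v,
    opTilde P r (tens P (mkB P u) v) = E (ofBt P (toTilde P r)) v := by
  refine T_induction P (C := fun u => ∃ E : B P →ₗ[ℂ] Bt P →ₗ[ℂ] H P, ∀ r v,
    opTilde P r (tens P (mkB P u) v) = E (ofBt P (toTilde P r)) v) ?_ ?_ ?_ ?_ u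
  · refine ⟨(LinearMap.llcomp ℂ (Bt P) (Bt P) (H P) (tensL P 1)) ∘ₗ LinearMap.mul ℂ (Bt P), ?_⟩
    intro r v
    rw [map_one, opTilde_one_tens]
    rfl
  · rintro x y ⟨E, hE⟩ ⟨F, hF⟩
    refine ⟨E + F, fun r v => ?_⟩
    rw [map_add, tens_add_left, map_add, hE, hF]
    rfl
  · rintro a x ⟨E, hE⟩
    refine ⟨a • E, fun r v => ?_⟩
    rw [map_smul, tens_smul_left, map_smul, hE]
    rfl
  · rintro j u ⟨E, hE⟩
    have hE' : ∀ i b v, opT P i (E b v) = E (ofBt P (yb P i * toBt P b)) v := by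
      intro i b v
      obtain ⟨r, hr⟩ := toTilde_surjective P (toBt P b)
      have h1 : b = ofBt P (toTilde P r) := by rw [hr]; rfl
      rw [h1, ← hE, ← opTilde_step, hE, toTilde_step]
      rfl
    refine ⟨pull P j E, fun r v => ?_⟩
    refine T_induction P (C := fun r => opTilde P r (tens P (mkB P (tb P j * u)) v) =
      pull P j E (ofBt P (toTilde P r)) v) ?_ ?_ ?_ ?_ r
    · have h0 : ofBt P (toTilde P 1) = 1 := by rw [map_one]; rfl
      have h1 := hE 1 v
      rw [h0, map_one, Module.End.one_apply] at h1
      rw [h0, map_one, pull_homog P j E (homog_one P), DB_one, map_zero, ← h1, one_smul, lam_tens,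
        map_mul, LinearMap.zero_apply, add_zero]
      rfl
    · intro x y hx hy
      rw [map_add, LinearMap.add_apply, hx, hy, map_add (toTilde P), ← LinearMap.add_apply,
        ← map_add]
      rfl
    · intro a x hx
      rw [map_smul, LinearMap.smul_apply, hx, map_smul (toTilde P), ← LinearMap.smul_apply,
        ← map_smul]
      rfl
    · intro i x hx
      rw [opTilde_step, hx, pull_step P j i E (hE' i), toTilde_step]
      rfl

theorem opTilde_eq_zero (r : T P) (hr : toTilde P r = 0) : opTilde P r = 0 := by
  apply H_ext
  intro x v
  obtain ⟨u, rfl⟩ := mkB_surjective P x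
  obtain ⟨E, hE⟩ := exists_op P u
  rw [hE, hr]
  exact LinearMap.congr_fun (map_zero E) v

/-- Left multiplication by `1 ⊗ b` on `𝓑(V*) ⊗ 𝓑̃(V)`. -/
def opB : Bt P →ₗ[ℂ] Module.End ℂ (H P) :=
  factor (toTilde P).toLinearMap (toTilde_surjective P) (opTilde P).toLinearMap
    (opTilde_eq_zero P)

theorem opB_toTilde (r : T P) : opB P (toTilde P r) = opTilde P r :=
  factor_apply (toTilde P).toLinearMap (toTilde_surjective P) _ _ r

theorem opB_one_tens (b v : Bt P) : opB P b (tens P 1 v) = tens P 1 (b * v) := by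
  obtain ⟨r, rfl⟩ := toTilde_surjective P b
  rw [opB_toTilde, opTilde_one_tens]

theorem opB_yb (i : ι) : opB P (yb P i) = opT P i := by
  have h : toTilde P (tb P i) = yb P i := liftT_tb P _ _ _
  rw [← h, opB_toTilde, opTilde, liftT_tb]

theorem opB_one : opB P 1 = 1 := by
  rw [← map_one (toTilde P), opB_toTilde, map_one]

theorem opB_mul (a b : Bt P) : opB P (a * b) = opB P a * opB P b := by
  obtain ⟨r, rfl⟩ := toTilde_surjective P a
  obtain ⟨t, rfl⟩ := toTilde_surjective P b
  rw [← map_mul, opB_toTilde, opB_toTilde, opB_toTilde, map_mul]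

/-- The product of `𝓑(V*) ⊗ 𝓑̃(V)`, as the map sending an element to the left multiplication by
it. Left multiplication by `x ⊗ b` is left multiplication by `1 ⊗ b` followed by that by `x ⊗ 1`. -/
def mulH : H P →ₗ[ℂ] Module.End ℂ (H P) :=
  TensorProduct.lift ((LinearMap.mul ℂ (Module.End ℂ (H P))).compl₁₂ (lamL P) (opB P))

theorem mulH_tens (x : B P) (b : Bt P) : mulH P (tens P x b) = lam P x * opB P b := by
  exact TensorProduct.lift.tmul _ _

theorem mulH_lam (x : B P) (m : H P) : mulH P (lam P x m) = lam P x * mulH P m := by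
  refine H_induction P (C := fun m => mulH P (lam P x m) = lam P x * mulH P m) ?_ ?_ m
  · intro u v
    rw [lam_tens, mulH_tens, mulH_tens, ← mul_assoc]
    congr 1
    ext1 m
    exact lam_mul P x u m
  · intro m m' hm hm'
    rw [map_add, map_add, map_add, hm, hm', mul_add]

theorem mulH_opT (i : ι) (m : H P) : mulH P (opT P i m) = opT P i * mulH P m := by
  refine H_induction P (C := fun m => mulH P (opT P i m) = opT P i * mulH P m) ?_ ?_ m
  · intro u v
    rw [opT_tens, map_add, mulH_tens, mulH_tens, mulH_tens, opB_mul, opB_yb]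
    ext1 m
    exact (opT_lam P i u (opB P v m)).symm
  · intro m m' hm hm'
    rw [map_add, map_add, map_add, hm, hm', mul_add]

theorem mulH_opB (b : Bt P) (m : H P) : mulH P (opB P b m) = opB P b * mulH P m := by
  obtain ⟨r, rfl⟩ := toTilde_surjective P b
  rw [opB_toTilde]
  refine T_induction P (C := fun r => mulH P (opTilde P r m) = opTilde P r * mulH P m)
    ?_ ?_ ?_ ?_ r
  · rw [map_one, one_mul]; rfl
  · intro x y hx hy
    rw [map_add, LinearMap.add_apply, map_add, hx, hy, add_mul]
  · intro a x hx
    rw [map_smul, LinearMap.smul_apply, map_smul, hx, smul_mul_assoc]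
  · intro i x hx
    rw [opTilde_step, mulH_opT, hx, map_mul, opTilde, liftT_tb, mul_assoc]

theorem mulH_mulH (m n : H P) : mulH P (mulH P m n) = mulH P m * mulH P n := by
  refine H_induction P (C := fun m => mulH P (mulH P m n) = mulH P m * mulH P n) ?_ ?_ m
  · intro u v
    rw [mulH_tens, Module.End.mul_apply, mulH_lam, mulH_opB, mul_assoc]
  · intro m m' hm hm'
    rw [map_add, LinearMap.add_apply, map_add, hm, hm', add_mul]

/-- The algebra `𝓑(V*) ⊗ 𝓑̃(V)`; its product is described by `cross_mul` and `left_mul`. -/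
instance : Ring (H P) where
  __ := (inferInstance : AddCommGroup (H P))
  mul m n := mulH P m n
  one := tens P 1 1
  left_distrib m n k := map_add (mulH P m) n k
  right_distrib m n k := by
    change mulH P (m + n) k = mulH P m k + mulH P n k
    rw [map_add]
    rfl
  zero_mul m := by
    change mulH P 0 m = 0
    rw [map_zero]
    rfl
  mul_zero m := map_zero (mulH P m)
  mul_assoc m n k := by
    change mulH P (mulH P m n) k = mulH P m (mulH P n k)
    rw [mulH_mulH]
    rfl
  one_mul m := by
    change mulH P (tens P 1 1) m = m
    rw [mulH_tens, opB_one, mul_one, lam_one]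
  mul_one m := by
    change mulH P m (tens P 1 1) = m
    refine H_induction P (C := fun m => mulH P m (tens P 1 1) = m) ?_ ?_ m
    · intro u v
      rw [mulH_tens, Module.End.mul_apply, opB_one_tens, lam_tens, mul_one, mul_one]
    · intro m m' hm hm'
      rw [map_add, LinearMap.add_apply, hm, hm']

theorem H_mul_def (m n : H P) : m * n = mulH P m n := rfl

instance : Algebra ℂ (H P) :=
  Algebra.ofModule
    (fun r m n => by
      rw [H_mul_def, H_mul_def, map_smul]
      rfl)
    (fun r m n => by
      rw [H_mul_def, H_mul_def, map_smul])

/-- `(x ⊗ [α]) (u ⊗ v) = x D̄_α(u) ⊗ v + x s_α(u) ⊗ [α] * v`. -/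
theorem cross_mul (x u : B P) (i : ι) (v : Bt P) : tens P x (yb P i) * tens P u v =
    tens P (x * dbar P i u) v + tens P (x * act P (s P i) u) (yb P i * v) := by
  rw [H_mul_def, mulH_tens, Module.End.mul_apply, opB_yb, opT_tens, map_add, lam_tens, lam_tens]

/-- `(x ⊗ 1) (u ⊗ v) = x u ⊗ v`. -/
theorem left_mul (x u : B P) (v : Bt P) : tens P x 1 * tens P u v = tens P (x * u) v := by
  rw [H_mul_def, mulH_tens, Module.End.mul_apply, opB_one, Module.End.one_apply, lam_tens]

/-- `(x ⊗ b) (1 ⊗ v) = x ⊗ b * v`. -/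
theorem right_mul (x : B P) (b v : Bt P) : tens P x b * tens P 1 v = tens P x (b * v) := by
  rw [H_mul_def, mulH_tens, Module.End.mul_apply, opB_one_tens, lam_tens, mul_one]


/-! ### Length, height and the quantum parameters -/

section Quantum

variable {P} (b : P.Base)

/-- The length of `w ∈ W`: the least number of factors in an expression of `w` as a product of
simple reflections. -/
def len (w : P.weylGroup) : ℕ :=
  sInf {n | ∃ l : List b.support, l.length = n ∧ (l.map fun j => s P j.1).prod = w}

/-- `l = (α_1, …, α_l)` is a reduced decomposition of `w`: the `α_k` are simple,
`w = s_{α_1} ⋯ s_{α_l}`, and `l` is the length of `w`. -/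
def IsReducedWord (w : P.weylGroup) (l : List b.support) : Prop :=
  (l.map fun j => s P j.1).prod = w ∧ l.length = len b w

/-- The coefficient `m_j` of the simple coroot `α_j^∨` in the coroot `α^∨`. -/
def corootCoeff (i : ι) (j : b.support) : ℤ :=
  b.flip.toWeightBasisInt.repr (P.flip.rootSpanMem ℤ i) j

theorem coroot_eq_sum (i : ι) :
    P.coroot i = ∑ j : b.support, corootCoeff b i j • P.coroot j.1 := by
  have h := b.flip.toWeightBasisInt.sum_repr (P.flip.rootSpanMem ℤ i)
  have h2 := congrArg (P.flip.rootSpan ℤ).subtype h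
  rw [map_sum] at h2
  simp only [map_smul, Submodule.subtype_apply, RootPairing.Base.coe_toWeightBasisInt_apply] at h2
  exact h2.symm

/-- The height `ht(α^∨)` of the coroot `α^∨`. -/
def coht (i : ι) : ℤ := ∑ j : b.support, corootCoeff b i j

/-- The set `Δ̃_+` of positive roots `α` with `l(s_α) = 2 ht(α^∨) - 1`. -/
def IsTilde (i : ι) : Prop := b.IsPos i ∧ (len b (s P i) : ℤ) = 2 * coht b i - 1

/-- The ring `R` of polynomials over `ℂ` in the variables `q^{α^∨}`, for `α` simple. -/
abbrev QRing : Type _ := MvPolynomial b.support ℂ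

/-- The monomial `q^{α^∨}`, for a positive root `α`; it is the product of the `(q^{α_j^∨})^{m_j}`
if `α^∨` is the sum of the `m_j α_j^∨`. -/
def qmon (i : ι) : QRing b :=
  ∏ j : b.support, (MvPolynomial.X j : QRing b) ^ (corootCoeff b i j).toNat

/-- The algebra `𝓑_R(V*) ⊗_R 𝓑̃_R(V)`, the scalar extension from `ℂ` to `R` of
`𝓑(V*) ⊗ 𝓑̃(V)`. -/
abbrev HR : Type _ := QRing b ⊗[ℂ] H P

open Classical in
/-- The quantized element of the root `α`: it is
`c_α [α] ⊗ 1 + d_α q^{α^∨} ⊗ [α_1] * ⋯ * [α_l]` for `α ∈ Δ̃_+` and `c_α [α] ⊗ 1` otherwise. Here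
`word α = (α_1, …, α_l)`, and `d_α = (c_{α_1} ⋯ c_{α_l})⁻¹`. -/
def qbr (c : ι → ℂ) (word : ι → List b.support) (i : ι) : HR b :=
  (1 : QRing b) ⊗ₜ[ℂ] (c i • tens P (xb P i) 1) +
    if IsTilde b i then
      (((word i).map fun j => c j.1).prod⁻¹ • qmon b i) ⊗ₜ[ℂ]
        tens P 1 ((word i).map fun j => yb P j.1).prod
    else 0

/-- The `R`-linear map `μ̃ : 𝔥_R → 𝓑_R(V*) ⊗_R 𝓑̃_R(V)`, the sum of the `(x, α)` times the
quantized element of `α`, over the positive roots `α`. -/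
def muTilde (c : ι → ℂ) (word : ι → List b.support) : QRing b ⊗[ℂ] N →ₗ[QRing b] HR b :=
  LinearMap.liftBaseChange (QRing b)
    (∑ i ∈ (Set.toFinite {i | b.IsPos i}).toFinset,
      (P.toLinearMap (P.root i)).smulRight (qbr b c word i))

end Quantum

end RootNichols

end

/-!
# Commutativity of the quantized elements

Write `(x ∧ y)(α, β) = (x, α) (y, β) - (y, α) (x, β)`, and let `A_α + q_α K_α` be the classical and
the quantum part of the quantized element of a positive root `α`. The commutator of `μ̃(x)` and
`μ̃(y)` is the sum over pairs of positive roots of `(x ∧ y)(α, β)` times the product of their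
quantized elements, and it is expanded by the number of quantum parts.

* Without quantum parts, the sum is an element of degree two of the Nichols algebra that is killed
  by all skew derivations. By the definition of `I(V)` as the kernel of the duality pairing, an
  element without constant term that is killed by all skew derivations is zero
  (`eq_zero_of_DB_eq_zero`, `sum_wedge_mul_eq_zero`).

* The quantum parts are controlled by the elements `Y_w`, the products of the `c_α⁻¹ [α]` along
  reduced words. The skew derivative of the product of a word is a sum over deletions of letters
  with coefficients that telescope to the change of sign of a root under `w` (`wordY_mul_DBt`).
  By induction on the length and the same criterion for vanishing, the product of a word depends
  only on its length and on `w`, and vanishes if the word is not reduced (`wordY_congr`,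
  `wordY_eq_zero`). Neither the braid relations nor Matsumoto's theorem are needed. So the `Y_w`
  multiply as in the nil-Coxeter algebra (`nilY_mul`). Rescaling by the `c_α` absorbs the `d_α`.

* With one quantum part, moving `[α] ⊗ 1` past `1 ⊗ Y_{s_β}` replaces `[α]` by `[s_β(α)]`, which does
  not change the sum, and leaves the terms `q^{β^∨} Y_{s_β s_γ}` for the positive roots `γ` such that
  `s_β s_γ` has length one less than `s_β` (`sum_commutator_qY`).

* With two quantum parts, there remain the terms `q^{α^∨ + β^∨} Y_{s_α s_β}` for which the lengths
  add up. These cancel for orthogonal roots, and vanish for roots at an acute angle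
  (`sum_qY_mul_qY`).

The remaining terms of the last two kinds cancel. If `α_1`, `α_2` are at an obtuse angle then
`α_1^∨ + α_2^∨` is a coroot `β^∨`, and `s_{α_1} s_{α_2} = s_β s_γ` for a root `γ` with
`(x ∧ y)(γ, β) = (x ∧ y)(α_1, α_2)`. This is a bijection between the two index sets, because
`2 ht(β^∨) - 1` bounds the length of `s_β` from above (`len_s_le`), with equality forcing
`⟨γ, β^∨⟩ = 1` for all inversions `γ ≠ β` of `s_β` (`pairing_eq_one_of_isTilde`). In the rank two root
system spanned by `β` and `γ` one then recovers `α_1` and `α_2`; for `G_2` their positivity needs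
that the length drops by one only (`DescentPair.isPos_or`).
-/

set_option linter.unusedSectionVars false

noncomputable section

namespace RootNichols

variable {ι M N : Type*} [Finite ι] [AddCommGroup M] [Module ℂ M] [AddCommGroup N] [Module ℂ N]
  {P : RootPairing ι ℂ M N} [P.IsCrystallographic]

/-! ### Roots, coroots and heights under reflections -/

theorem root_s_smul (j i : ι) :
    P.root (s P j • i) = P.root i - P.pairingIn ℤ i j • P.root j := by
  change P.root (P.reflectionPerm j i) = _
  rw [P.root_reflectionPerm, P.reflection_apply_root' ℤ]

theorem coroot_s_smul (j i : ι) :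
    P.coroot (s P j • i) = P.coroot i - P.pairingIn ℤ j i • P.coroot j := by
  change P.coroot (P.reflectionPerm j i) = _
  rw [P.coroot_reflectionPerm, P.coreflection_apply_coroot, ← P.algebraMap_pairingIn ℤ,
    algebraMap_int_eq, eq_intCast, Int.cast_smul_eq_zsmul]

theorem pairing_s_smul (k i j : ι) :
    P.pairingIn ℤ (s P k • i) (s P k • j) = P.pairingIn ℤ i j := by
  change P.pairingIn ℤ (P.reflectionPerm k i) (P.reflectionPerm k j) = _
  rw [P.pairingIn_reflectionPerm]
  have : P.reflectionPerm k (P.reflectionPerm k i) = i := by simp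
  rw [this]

theorem pairing_neg_left (i j : ι) : P.pairingIn ℤ (neg P i) j = -P.pairingIn ℤ i j :=
  P.pairingIn_reflectionPerm_self_left ℤ i j

theorem pairing_neg_right (i j : ι) : P.pairingIn ℤ i (neg P j) = -P.pairingIn ℤ i j :=
  P.pairingIn_reflectionPerm_self_right ℤ i j

theorem smul_s_smul (k i : ι) : s P k • s P k • i = i := by
  rw [← mul_smul, s_mul_self, one_smul]

theorem pairing_s_smul_left (k i : ι) : P.pairingIn ℤ (s P k • i) k = -P.pairingIn ℤ i k := by
  rw [← pairing_s_smul k, smul_s_smul, s_smul_self, pairing_neg_right]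

theorem pairing_s_smul_right (k i : ι) : P.pairingIn ℤ k (s P k • i) = -P.pairingIn ℤ k i := by
  rw [← pairing_s_smul k, smul_s_smul, s_smul_self, pairing_neg_left]

theorem neg_eq_iff {i j : ι} : neg P i = j ↔ i = neg P j := by
  constructor
  · rintro rfl; rw [neg_neg]
  · rintro rfl; rw [neg_neg]

theorem pairing_self (i : ι) : P.pairingIn ℤ i i = 2 := by simp

variable (b : P.Base)

theorem height_s_smul (j i : ι) :
    b.height (s P j • i) = b.height i - P.pairingIn ℤ i j * b.height j := by
  have h : P.root (s P j • i) = P.root i + (-P.pairingIn ℤ i j) • P.root j := by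
    rw [root_s_smul, neg_smul, sub_eq_add_neg]
  rw [b.height_add_zsmul h, smul_eq_mul]
  ring

theorem height_neg (i : ι) : b.height (neg P i) = -b.height i :=
  b.height_reflectionPerm_self i

variable {b}

theorem isPos_neg {i : ι} : b.IsPos (neg P i) ↔ ¬ b.IsPos i := by
  rw [b.isPos_iff, b.isPos_iff, height_neg]
  have := b.height_ne_zero i
  lia

theorem isPos_s_smul_simple [P.IsReduced] {i j : ι} (hj : j ∈ b.support) (h1 : i ≠ j)
    (h2 : i ≠ neg P j) : b.IsPos (s P j • i) ↔ b.IsPos i := by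
  have key : ∀ i, i ≠ j → b.IsPos i → b.IsPos (s P j • i) := fun i h h' => h'.reflectionPerm hj h
  refine ⟨fun h => ?_, key i h1⟩
  have := key (s P j • i) ?_ h
  · rwa [smul_s_smul] at this
  · rintro h
    apply h2
    rw [← s_smul_self, ← smul_s_smul (P := P) j i, h]

/-- Every positive root is obtained from a simple one by simple reflections that increase
the height. -/
theorem isPos_induction [P.IsReduced] {C : ι → Prop} (h1 : ∀ i ∈ b.support, C i)
    (h2 : ∀ i, b.IsPos i → ∀ j ∈ b.support, i ≠ j → 0 < P.pairingIn ℤ j i →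
      b.IsPos (s P j • i) → C (s P j • i) → C i) (i : ι) (hi : b.IsPos i) : C i := by
  suffices h : ∀ (n : ℕ) (i : ι), b.IsPos i → b.height i ≤ n → C i from
    h (b.height i).toNat i hi (Int.self_le_toNat _)
  intro n
  induction n with
  | zero =>
    intro i hi hn
    rw [b.isPos_iff] at hi
    simp at hn
    lia
  | succ n ih =>
    intro i hi hn
    obtain ⟨j, hj, hp⟩ := hi.exists_mem_support_pos_pairingIn
    by_cases hij : i = j
    · exact hij ▸ h1 j hj
    · have h' := hi.reflectionPerm hj hij
      refine h2 i hi j hj hij hp h' (ih _ h' ?_)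
      have h3 := (P.zero_lt_pairingIn_iff' (S := ℤ)).1 hp
      rw [height_s_smul, b.height_one_of_mem_support hj]
      push_cast at hn
      lia

/-! ### Coefficients and heights of coroots -/

theorem corootCoeff_add_zsmul {i j k : ι} {z : ℤ}
    (h : P.coroot k = P.coroot i + z • P.coroot j) (l : b.support) :
    corootCoeff b k l = corootCoeff b i l + z * corootCoeff b j l := by
  have h' : P.flip.rootSpanMem ℤ k = P.flip.rootSpanMem ℤ i + z • P.flip.rootSpanMem ℤ j := by
    apply Subtype.ext
    exact h
  rw [corootCoeff, h', map_add, map_smul]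
  rfl

theorem coht_add_zsmul {i j k : ι} {z : ℤ} (h : P.coroot k = P.coroot i + z • P.coroot j) :
    coht b k = coht b i + z * coht b j := by
  simp only [coht, corootCoeff_add_zsmul h, Finset.sum_add_distrib, Finset.mul_sum]

theorem coht_s_smul (j i : ι) :
    coht b (s P j • i) = coht b i - P.pairingIn ℤ j i * coht b j := by
  have h : P.coroot (s P j • i) = P.coroot i + (-P.pairingIn ℤ j i) • P.coroot j := by
    rw [coroot_s_smul, neg_smul, sub_eq_add_neg]
  rw [coht_add_zsmul h]
  ring

open Classical in
theorem corootCoeff_simple (i j : b.support) : corootCoeff b i.1 j = if i = j then 1 else 0 := by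
  have h : P.flip.rootSpanMem ℤ i.1 = b.flip.toWeightBasisInt i :=
    Subtype.ext (b.flip.coe_toWeightBasisInt_apply i).symm
  have h2 := b.flip.toWeightBasisInt.repr_self i
  rw [corootCoeff, h, h2]
  convert Finsupp.single_apply
  rfl

theorem coht_simple {i : ι} (hi : i ∈ b.support) : coht b i = 1 := by
  have := fun j => corootCoeff_simple ⟨i, hi⟩ j
  simp [coht, this]

theorem corootCoeff_nonneg [P.IsReduced] {i : ι} (hi : b.IsPos i) (k : b.support) :
    0 ≤ corootCoeff b i k := by
  refine isPos_induction (b := b) (C := fun i => 0 ≤ corootCoeff b i k) ?_ ?_ i hi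
  · intro j hj
    rw [corootCoeff_simple ⟨j, hj⟩]
    split_ifs <;> norm_num
  · intro i _ j hj _ hp _ h
    have e : P.coroot i = P.coroot (s P j • i) + P.pairingIn ℤ j i • P.coroot j := by
      rw [coroot_s_smul, sub_add_cancel]
    have h1 : 0 ≤ corootCoeff b j k := by
      rw [corootCoeff_simple ⟨j, hj⟩]
      split_ifs <;> norm_num
    rw [corootCoeff_add_zsmul e]
    positivity

/-- `q^{α^∨} q^{β^∨} = q^{γ^∨}` if `γ^∨ = α^∨ + β^∨`. -/
theorem qmon_mul [P.IsReduced] {i j k : ι} (hi : b.IsPos i) (hj : b.IsPos j)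
    (h : P.coroot k = P.coroot i + P.coroot j) : qmon b i * qmon b j = qmon b k := by
  have h' : P.coroot k = P.coroot i + (1 : ℤ) • P.coroot j := by rw [h, one_smul]
  rw [qmon, qmon, qmon, ← Finset.prod_mul_distrib]
  refine Finset.prod_congr rfl fun l _ => ?_
  rw [← pow_add, corootCoeff_add_zsmul h', one_mul,
    Int.toNat_add (corootCoeff_nonneg hi l) (corootCoeff_nonneg hj l)]

/-! ### Words in simple reflections and the length function -/

variable (P) in
/-- The element `s_{α_1} ⋯ s_{α_l}` of `W` for a word `(α_1, …, α_l)` in simple roots. -/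
def wordProd (l : List b.support) : P.weylGroup := (l.map fun j => s P j.1).prod

theorem wordProd_nil : wordProd P ([] : List b.support) = 1 := rfl

theorem wordProd_cons (i : b.support) (l : List b.support) :
    wordProd P (i :: l) = s P i.1 * wordProd P l := by simp [wordProd]

theorem wordProd_append (l m : List b.support) :
    wordProd P (l ++ m) = wordProd P l * wordProd P m := by simp [wordProd]

theorem wordProd_reverse (l : List b.support) : wordProd P l.reverse = (wordProd P l)⁻¹ := by
  induction l with
  | nil => simp [wordProd]
  | cons i l ih =>
    rw [List.reverse_cons, wordProd_append, wordProd_cons, wordProd_cons, mul_inv_rev, ih, s_inv,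
      wordProd_nil, mul_one]

theorem exists_wordProd [P.IsReduced] (w : P.weylGroup) :
    ∃ l : List b.support, wordProd P l = w := by
  have hpos : ∀ i, b.IsPos i → ∃ l : List b.support, wordProd P l = s P i := by
    refine isPos_induction ?_ ?_
    · intro i hi
      exact ⟨[⟨i, hi⟩], by simp [wordProd]⟩
    · rintro i - j hj - - - ⟨l, hl⟩
      refine ⟨⟨j, hj⟩ :: (l ++ [⟨j, hj⟩]), ?_⟩
      rw [wordProd_cons, wordProd_append, hl, s_smul, s_inv]
      simp only [wordProd_cons, wordProd_nil, mul_one]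
      simp only [← mul_assoc, s_mul_self, one_mul]
      rw [mul_assoc, s_mul_self, mul_one]
  have hall : ∀ i, ∃ l : List b.support, wordProd P l = s P i := by
    intro i
    by_cases hi : b.IsPos i
    · exact hpos i hi
    · rw [← s_neg]
      exact hpos _ (isPos_neg.2 hi)
  obtain ⟨w, hw⟩ := w
  induction hw using RootPairing.weylGroup.induction with
  | mem i => exact hall i
  | one => exact ⟨[], rfl⟩
  | mul x y hx hy h1 h2 =>
    obtain ⟨l, hl⟩ := h1
    obtain ⟨m, hm⟩ := h2
    exact ⟨l ++ m, by rw [wordProd_append, hl, hm]; rfl⟩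

theorem len_wordProd_le (l : List b.support) : len b (wordProd P l) ≤ l.length :=
  Nat.sInf_le ⟨l, rfl, rfl⟩

variable (b) in
theorem exists_reducedWord [P.IsReduced] (w : P.weylGroup) :
    ∃ l : List b.support, IsReducedWord b w l := by
  obtain ⟨l, hl⟩ := exists_wordProd (b := b) w
  have h : (∃ n, n ∈ {n | ∃ l : List b.support, l.length = n ∧
      (l.map fun j => s P j.1).prod = w}) := ⟨l.length, l, rfl, hl⟩
  obtain ⟨m, hm1, hm2⟩ := Nat.sInf_mem h
  exact ⟨m, hm2, hm1⟩

theorem len_inv [P.IsReduced] (w : P.weylGroup) : len b w⁻¹ = len b w := by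
  have key : ∀ w : P.weylGroup, len b w⁻¹ ≤ len b w := by
    intro w
    obtain ⟨l, hl, hl'⟩ := exists_reducedWord b w
    rw [← hl', ← l.length_reverse]
    have h := len_wordProd_le l.reverse
    rwa [wordProd_reverse, show wordProd P l = w from hl] at h
  refine le_antisymm (key w) ?_
  have h := key w⁻¹
  rwa [inv_inv] at h

theorem len_mul_le [P.IsReduced] (w w' : P.weylGroup) :
    len b (w * w') ≤ len b w + len b w' := by
  obtain ⟨l, hl, hl'⟩ := exists_reducedWord b w
  obtain ⟨m, hm, hm'⟩ := exists_reducedWord b w'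
  rw [← hl', ← hm', ← List.length_append]
  have h := len_wordProd_le (l ++ m)
  rwa [wordProd_append, show wordProd P l = w from hl, show wordProd P m = w' from hm] at h

/-- Strong exchange: if `w` changes the sign of the root `α`, then some letter of any word for `w`
may be deleted to give a word for `w s_α`. -/
theorem exists_deletion [P.IsReduced] (j : ι) (l : List b.support)
    (h : ¬(b.IsPos (wordProd P l • j) ↔ b.IsPos j)) :
    ∃ m : List b.support, m.length + 1 = l.length ∧ wordProd P m = wordProd P l * s P j := by
  induction l with
  | nil => simp [wordProd] at h
  | cons i l ih =>
    by_cases h' : b.IsPos (wordProd P l • j) ↔ b.IsPos j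
    · -- Here `s_i` changes the sign of `l • j`, so that `l • j` is the simple root `i` up to sign.
      refine ⟨l, rfl, ?_⟩
      have h2 : s P i.1 = s P (wordProd P l • j) := by
        rw [wordProd_cons, mul_smul] at h
        by_cases e1 : wordProd P l • j = i.1
        · rw [e1]
        · by_cases e2 : wordProd P l • j = neg P i.1
          · rw [e2, s_neg]
          · exact absurd ((isPos_s_smul_simple i.2 e1 e2).trans h') h
      rw [wordProd_cons, h2, s_smul, inv_mul_cancel_right, mul_assoc, s_mul_self, mul_one]
    · obtain ⟨m, hm, hm'⟩ := ih h'
      exact ⟨i :: m, by simp [hm], by rw [wordProd_cons, wordProd_cons, hm', mul_assoc]⟩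

theorem len_mul_s_lt_of_changes [P.IsReduced] {w : P.weylGroup} {j : ι}
    (h : ¬(b.IsPos (w • j) ↔ b.IsPos j)) : len b (w * s P j) < len b w := by
  obtain ⟨l, hl, hl'⟩ := exists_reducedWord b w
  change wordProd P l = w at hl
  rw [← hl] at h
  obtain ⟨m, hm, hm'⟩ := exists_deletion j l h
  rw [← hl', ← hl, ← hm']
  have := len_wordProd_le m
  lia

theorem len_mul_s_lt [P.IsReduced] {w : P.weylGroup} {j : ι} (hj : b.IsPos j)
    (h : ¬ b.IsPos (w • j)) : len b (w * s P j) < len b w :=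
  len_mul_s_lt_of_changes (by tauto)

theorem lt_len_mul_s [P.IsReduced] {w : P.weylGroup} {j : ι} (hj : b.IsPos j)
    (h : b.IsPos (w • j)) : len b w < len b (w * s P j) := by
  have h1 := len_mul_s_lt (w := w * s P j) hj (by
    rw [mul_smul, s_smul_self, smul_neg, isPos_neg]
    exact not_not.2 h)
  rwa [mul_assoc, s_mul_self, mul_one] at h1

/-! ### The length of a reflection -/

theorem len_s_conj_le [P.IsReduced] {j : ι} (hj : j ∈ b.support) (i : ι) :
    len b (s P i) ≤ len b (s P (s P j • i)) + 2 := by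
  have hs : len b (s P j) ≤ 1 := by
    have := len_wordProd_le (P := P) [(⟨j, hj⟩ : b.support)]
    simpa [wordProd] using this
  have e : s P i = s P j * s P (s P j • i) * s P j := by
    rw [s_smul, s_inv]
    simp only [← mul_assoc, s_mul_self, one_mul]
    rw [mul_assoc, s_mul_self, mul_one]
  have h1 := len_mul_le (b := b) (s P j * s P (s P j • i)) (s P j)
  have h2 := len_mul_le (b := b) (s P j) (s P (s P j • i))
  rw [← e] at h1
  lia

/-- The length of `s_α` is at most `2 ht(α^∨) - 1`, so that `Δ̃_+` consists of the roots with
equality. -/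
theorem len_s_le [P.IsReduced] {i : ι} (hi : b.IsPos i) :
    (len b (s P i) : ℤ) ≤ 2 * coht b i - 1 := by
  refine isPos_induction (b := b) (C := fun i => (len b (s P i) : ℤ) ≤ 2 * coht b i - 1)
    ?_ ?_ i hi
  · intro j hj
    have := len_wordProd_le (P := P) [(⟨j, hj⟩ : b.support)]
    have hs : len b (s P j) ≤ 1 := by simpa [wordProd] using this
    rw [coht_simple hj]
    lia
  · intro i _ j hj _ hp _ h
    rw [coht_s_smul, coht_simple hj] at h
    have := len_s_conj_le hj i
    lia

/-- If `β ∈ Δ̃_+` then `⟨γ, β^∨⟩ = 1` for all inversions `γ ≠ β` of `s_β`. -/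
theorem pairing_eq_one_of_isTilde [P.IsReduced] {i : ι} (hi : IsTilde b i) {k : ι}
    (hk : b.IsPos k) (hik : ¬ b.IsPos (s P i • k)) (hne : k ≠ i) : P.pairingIn ℤ k i = 1 := by
  obtain ⟨hpos, hlen⟩ := hi
  refine isPos_induction (b := b) (C := fun i => (len b (s P i) : ℤ) = 2 * coht b i - 1 →
    ∀ k, b.IsPos k → ¬ b.IsPos (s P i • k) → k ≠ i → P.pairingIn ℤ k i = 1) ?_ ?_ i hpos hlen
    k hk hik hne
  · intro i hi _ k hk hik hne
    refine absurd ((isPos_s_smul_simple hi hne ?_).2 hk) hik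
    rintro rfl
    exact isPos_neg.1 hk (b.isPos_of_mem_support hi)
  · intro i hi j hj hij hp hpos' ih hlen k hk hik hne
    -- The bounds on lengths are all sharp, so `⟨α_j, β^∨⟩ = 1` and `s_j β ∈ Δ̃_+`.
    have h1 := len_s_conj_le hj i
    have h2 := len_s_le hpos'
    rw [coht_s_smul, coht_simple hj] at h2
    have hp1 : P.pairingIn ℤ j i = 1 := by lia
    by_cases hkj : k = j
    · rw [hkj, hp1]
    have hkj' : k ≠ neg P j := by
      rintro rfl
      exact isPos_neg.1 hk (b.isPos_of_mem_support hj)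
    by_cases e : s P i • k = neg P j
    · have h3 := pairing_s_smul_left (P := P) i k
      rw [e, pairing_neg_left, hp1] at h3
      lia
    have e' : s P i • k ≠ j := by
      intro e'
      exact hik (e' ▸ b.isPos_of_mem_support hj)
    have h3 := ih (by rw [coht_s_smul, coht_simple hj]; lia) (s P j • k)
      ((isPos_s_smul_simple hj hkj hkj').2 hk) (by
        have : s P (s P j • i) • s P j • k = s P j • s P i • k := by
          rw [← mul_smul, ← mul_smul, s_smul, inv_mul_cancel_right]
        rw [this, isPos_s_smul_simple hj e' e]
        exact hik) (by
        intro e2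
        apply hne
        rw [← smul_s_smul (P := P) j k, e2, smul_s_smul])
    rwa [pairing_s_smul] at h3

/-! ### Skew derivations detect zero in the Nichols algebra -/

variable (P) in
/-- The counit of `𝓑(V)`. -/
def counitB : B P →ₗ[ℂ] ℂ :=
  factor (mkB P).toLinearMap (mkB_surjective P) (counit P).toLinearMap
    (fun _ hx => counit_of_mem_ker P ((mkB_eq_zero P).1 hx))

theorem counitB_mk (x : T P) : counitB P (mkB P x) = counit P x :=
  factor_apply (mkB P).toLinearMap (mkB_surjective P) _ _ x

theorem counitB_mul (x y : B P) : counitB P (x * y) = counitB P x * counitB P y := by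
  obtain ⟨x, rfl⟩ := mkB_surjective P x
  obtain ⟨y, rfl⟩ := mkB_surjective P y
  rw [← map_mul, counitB_mk, counitB_mk, counitB_mk, map_mul]

theorem counitB_xb (i : ι) : counitB P (xb P i) = 0 := by
  rw [xb, counitB_mk, counit_tb]

/-- An element of `𝓑(V)` without constant term that is killed by all skew derivations is zero,
because it lies in the kernel of the duality pairing. -/
theorem eq_zero_of_DB_eq_zero {x : B P} (h0 : counitB P x = 0) (h : ∀ i, DB P i x = 0) :
    x = 0 := by
  obtain ⟨y, rfl⟩ := mkB_surjective P x
  rw [mkB_eq_zero]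
  have hle := le_ker P (Submodule.span ℂ {y} ⊔ ker P) ?_ ?_
  · exact hle (Submodule.mem_sup_left (Submodule.mem_span_singleton_self y))
  · intro z hz
    obtain ⟨u, hu, v, hv, rfl⟩ := Submodule.mem_sup.1 hz
    obtain ⟨r, rfl⟩ := Submodule.mem_span_singleton.1 hu
    rw [counitB_mk] at h0
    rw [map_add, map_smul, h0, smul_zero, counit_of_mem_ker P hv, add_zero]
  · intro i z hz
    obtain ⟨u, hu, v, hv, rfl⟩ := Submodule.mem_sup.1 hz
    obtain ⟨r, rfl⟩ := Submodule.mem_span_singleton.1 hu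
    refine Submodule.mem_sup_right ?_
    rw [map_add, map_smul]
    refine add_mem (Submodule.smul_mem _ _ ?_) (DT_mem_ker P i hv)
    rw [← mkB_eq_zero, ← DB_mk]
    exact h i

/-! ### Skew derivations on the algebra with the modified product -/

variable (P) in
/-- The map `x ↦ x₍₁₎ ⟨[α], x₍₂₎⟩`, on `𝓑̃(V)`. -/
def DBt (i : ι) : Bt P →ₗ[ℂ] Bt P := DB P i

theorem DBt_one (i : ι) : DBt P i 1 = 0 := DB_one P i

theorem DBt_yb_mul {g : P.weylGroup} {x : Bt P} (hx : Homog P g (ofBt P x)) (i j : ι) :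
    DBt P j (yb P i * x) = pr P (g • j) i • x + yb P i * DBt P j x := by
  have h1 : yb P i * x = toBt P (ofBt P x * xb P (g⁻¹ • i)) := hx.yb_mul P i
  have h2 : yb P i * DBt P j x = toBt P (DB P j (ofBt P x) * xb P ((g * s P j)⁻¹ • i)) :=
    (hx.DB P j).yb_mul P i
  have h3 : pr P (g • j) i = pr P j (g⁻¹ • i) := by
    rw [← pr_smul P g⁻¹, inv_smul_smul]
  have h4 := DB_mul P j (ofBt P x) (xb P (g⁻¹ • i))
  rw [DB_xb, act_xb, mul_smul_comm, mul_one] at h4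
  rw [h1, h2, h3, mul_inv_rev, s_inv, mul_smul]
  exact h4

theorem Homog.smul {g : P.weylGroup} {x : B P} (hx : Homog P g x) (r : ℂ) :
    Homog P g (r • x) := by
  unfold Homog at *
  rw [map_smul, hx, MonoidAlgebra.smul_single]

theorem Homog.yb_mul_mem {g : P.weylGroup} {x : Bt P} (hx : Homog P g (ofBt P x)) (i : ι) :
    Homog P (s P i * g) (ofBt P (yb P i * x)) :=
  (homog_xb P i).star_mem P hx

theorem counitB_yb_mul (x : Bt P) (i : ι) : counitB P (ofBt P (yb P i * x)) = 0 := by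
  refine homog_induction P (C := fun x => counitB P (ofBt P (yb P i * toBt P x)) = 0) ?_ ?_ ?_ x
  · intro x y hx hy
    have : ofBt P (yb P i * toBt P (x + y)) = ofBt P (yb P i * toBt P x) +
      ofBt P (yb P i * toBt P y) := star_add P _ _ _
    rw [this, map_add, hx, hy, add_zero]
  · intro r x hx
    have : ofBt P (yb P i * toBt P (r • x)) = r • ofBt P (yb P i * toBt P x) :=
      star_smul P _ _ _
    rw [this, map_smul, hx, smul_zero]
  · intro g x hx
    rw [hx.yb_mul]
    have := counitB_mul x (xb P (g⁻¹ • i))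
    rwa [counitB_xb, mul_zero] at this

/-! ### Products of simple root vectors -/

open Classical in
variable (b) in
/-- The indicator function of the positive roots. -/
def posInd (i : ι) : ℂ := if b.IsPos i then 1 else 0

theorem posInd_of_pos {i : ι} (h : b.IsPos i) : posInd b i = 1 := if_pos h

theorem posInd_of_not_pos {i : ι} (h : ¬ b.IsPos i) : posInd b i = 0 := if_neg h

theorem posInd_congr {i j : ι} (h : b.IsPos i ↔ b.IsPos j) : posInd b i = posInd b j := by
  classical
  exact if_congr h rfl rfl

/-- A simple reflection changes the sign of no roots but the simple one and its negative, so that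
the pairing with a simple root vector measures the change of sign. -/
theorem pr_simple [P.IsReduced] {i : ι} (hi : i ∈ b.support) (k : ι) :
    pr P k i = posInd b k - posInd b (s P i • k) := by
  have hpos := b.isPos_of_mem_support hi
  have hneg : ¬ b.IsPos (neg P i) := fun h => isPos_neg.1 h hpos
  have hne : i ≠ neg P i := fun h => hneg (h ▸ hpos)
  by_cases h1 : k = i
  · rw [h1, s_smul_self, posInd_of_pos hpos, posInd_of_not_pos hneg]
    simp [pr, hne]
  · by_cases h2 : k = neg P i
    · rw [h2, smul_neg, s_smul_self, neg_neg, posInd_of_pos hpos, posInd_of_not_pos hneg]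
      simp [pr, hne.symm]
    · rw [posInd_congr (isPos_s_smul_simple hi h1 h2), sub_self]
      simp [pr, h1, h2]

/-- The product `c_{α_1}⁻¹ [α_1] * ⋯ * c_{α_l}⁻¹ [α_l]` in `𝓑̃(V)` for a word in simple roots. -/
def wordY (c : ι → ℂ) (l : List b.support) : Bt P :=
  (l.map fun j => (c j.1)⁻¹ • yb P j.1).prod

variable {c : ι → ℂ}

theorem wordY_nil : wordY (P := P) c ([] : List b.support) = 1 := rfl

theorem wordY_cons (i : b.support) (l : List b.support) :
    wordY (P := P) c (i :: l) = (c i.1)⁻¹ • (yb P i.1 * wordY c l) := by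
  simp [wordY]

theorem wordY_append (l m : List b.support) :
    wordY (P := P) c (l ++ m) = wordY c l * wordY c m := by
  simp [wordY]

theorem wordY_eq (l : List b.support) : wordY (P := P) c l =
    (l.map fun j => c j.1).prod⁻¹ • (l.map fun j => yb P j.1).prod := by
  induction l with
  | nil => simp [wordY]
  | cons i l ih =>
    rw [wordY_cons, ih, List.map_cons, List.prod_cons, List.map_cons, List.prod_cons, mul_inv_rev,
      mul_smul_comm, smul_smul, mul_comm]

theorem homog_wordY (l : List b.support) : Homog P (wordProd P l) (ofBt P (wordY c l)) := by
  induction l with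
  | nil => exact homog_one P
  | cons i l ih =>
    rw [wordY_cons, wordProd_cons]
    exact Homog.smul (Homog.yb_mul_mem ih i.1) _

/-- The skew derivation of a word is a sum over the deletions of one letter. The deletions that
contribute give words with the same product, and if these have a common value `Z` then the sum
of the coefficients telescopes. -/
theorem wordY_mul_DBt [P.IsReduced]
    (hcW : ∀ (w : P.weylGroup) (i : ι), c (w • i) = c i) (j : ι) (Z : Bt P) (l : List b.support) :
    ∀ pre : List b.support, (∀ m : List b.support, m.length + 1 = pre.length + l.length →
      wordProd P m = wordProd P pre * wordProd P l * s P j → wordY c m = Z) →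
    wordY c pre * DBt P j (wordY c l) =
      ((c j)⁻¹ * (posInd b j - posInd b (wordProd P l • j))) • Z := by
  induction l with
  | nil =>
    intro pre _
    rw [wordY_nil, DBt_one, mul_zero, wordProd_nil, one_smul, sub_self, mul_zero, zero_smul]
  | cons i l ih =>
    intro pre hZ
    have h1 := ih (pre ++ [i]) (by
      intro m hm hm'
      refine hZ m ?_ ?_
      · simp at hm ⊢; lia
      · rw [hm', wordProd_append, wordProd_cons, wordProd_cons, wordProd_nil, mul_one]
        simp only [mul_assoc])
    have h2 : pr P (wordProd P l • j) i.1 • ((c i.1)⁻¹ • wordY c (pre ++ l)) =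
        ((c j)⁻¹ * pr P (wordProd P l • j) i.1) • Z := by
      by_cases h : pr P (wordProd P l • j) i.1 = 0
      · rw [h, zero_smul, mul_zero, zero_smul]
      · have hs := s_eq_of_pr_ne_zero P h
        have hcij : c i.1 = c j := by
          rw [← hcW (wordProd P l) j]
          unfold pr at h
          by_cases h3 : wordProd P l • j = i.1
          · rw [h3]
          · by_cases h4 : wordProd P l • j = neg P i.1
            · rw [h4, ← s_smul_self, hcW]
            · simp [h3, h4] at h
        rw [hZ (pre ++ l) (by simp; lia) (by
          rw [wordProd_append, wordProd_cons, hs, s_smul, inv_mul_cancel_right]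
          simp only [mul_assoc, s_mul_self, mul_one]), hcij, smul_smul, mul_comm]
    have h5 : wordY c pre * DBt P j (wordY c (i :: l)) =
        pr P (wordProd P l • j) i.1 • ((c i.1)⁻¹ • wordY c (pre ++ l)) +
          wordY c (pre ++ [i]) * DBt P j (wordY c l) := by
      rw [wordY_cons, map_smul, DBt_yb_mul (homog_wordY l), wordY_append, wordY_append, wordY_cons,
        wordY_nil, mul_one, smul_add, mul_add, smul_comm, mul_smul_comm, mul_smul_comm,
        mul_smul_comm, mul_smul_comm, smul_mul_assoc, mul_assoc]
    rw [h5, h1, h2, ← add_smul, pr_simple i.2, wordProd_cons, mul_smul (s P i.1)]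
    refine congrArg (fun r : ℂ => r • Z) ?_
    ring

theorem DBt_wordY [P.IsReduced]
    (hcW : ∀ (w : P.weylGroup) (i : ι), c (w • i) = c i) (j : ι) (Z : Bt P) (l : List b.support)
    (hZ : ∀ m : List b.support, m.length + 1 = l.length →
      wordProd P m = wordProd P l * s P j → wordY c m = Z) :
    DBt P j (wordY c l) = ((c j)⁻¹ * (posInd b j - posInd b (wordProd P l • j))) • Z := by
  have h := wordY_mul_DBt hcW j Z l [] (by simpa [wordProd_nil] using hZ)
  rwa [wordY_nil, one_mul] at h

theorem counitB_wordY_cons (i : b.support) (l : List b.support) :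
    counitB P (ofBt P (wordY c (i :: l))) = 0 := by
  rw [wordY_cons]
  have := (counitB P).map_smul (c i.1)⁻¹ (ofBt P (yb P i.1 * wordY c l))
  rwa [counitB_yb_mul, smul_zero] at this

/-- The product of a word depends only on its length and on the element of `W`. -/
theorem wordY_congr [P.IsReduced]
    (hcW : ∀ (w : P.weylGroup) (i : ι), c (w • i) = c i) (l l' : List b.support)
    (hlen : l.length = l'.length) (hw : wordProd P l = wordProd P l') :
    wordY (P := P) c l = wordY c l' := by
  obtain ⟨n, hn⟩ : ∃ n, n = l.length := ⟨_, rfl⟩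
  induction n generalizing l l' with
  | zero =>
    rw [List.length_eq_zero_iff.1 hn.symm, List.length_eq_zero_iff.1 (hn.trans hlen).symm]
  | succ n ih =>
    obtain ⟨i, k, rfl⟩ := List.exists_cons_of_length_eq_add_one hn.symm
    obtain ⟨i', k', rfl⟩ := List.exists_cons_of_length_eq_add_one (hn.trans hlen).symm
    rw [← sub_eq_zero]
    refine eq_zero_of_DB_eq_zero (x := ofBt P (wordY c (i :: k)) - ofBt P (wordY c (i' :: k')))
      ?_ ?_
    · rw [map_sub, counitB_wordY_cons, counitB_wordY_cons, sub_zero]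
    · intro j
      obtain ⟨Z, hZ⟩ : ∃ Z : Bt P, ∀ m : List b.support, m.length = n →
          wordProd P m = wordProd P (i :: k) * s P j → wordY c m = Z := by
        by_cases h : ∃ m : List b.support, m.length = n ∧
            wordProd P m = wordProd P (i :: k) * s P j
        · obtain ⟨m, hm, hm'⟩ := h
          refine ⟨wordY c m, fun m' h1 h2 => ?_⟩
          exact ih m' m (h1.trans hm.symm) (h2.trans hm'.symm) h1.symm
        · exact ⟨0, fun m h1 h2 => absurd ⟨m, h1, h2⟩ h⟩
      have h1 := DBt_wordY hcW j Z (i :: k) (fun m h1 h2 => hZ m (by lia) h2)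
      have h2 := DBt_wordY hcW j Z (i' :: k') (fun m h1 h2 => hZ m (by lia) (by rw [h2, hw]))
      rw [← hw, ← h1] at h2
      rw [map_sub, sub_eq_zero]
      exact h2.symm

/-- The product of a word that is not reduced vanishes. -/
theorem wordY_eq_zero [P.IsReduced]
    (hcW : ∀ (w : P.weylGroup) (i : ι), c (w • i) = c i) (l : List b.support)
    (hl : len b (wordProd P l) < l.length) : wordY (P := P) c l = 0 := by
  obtain ⟨n, hn⟩ : ∃ n, n = l.length := ⟨_, rfl⟩
  induction n generalizing l with
  | zero => lia
  | succ n ih =>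
    obtain ⟨i, k, rfl⟩ := List.exists_cons_of_length_eq_add_one hn.symm
    refine eq_zero_of_DB_eq_zero (x := ofBt P (wordY c (i :: k))) (counitB_wordY_cons i k) ?_
    intro j
    by_cases h : b.IsPos (wordProd P (i :: k) • j) ↔ b.IsPos j
    · -- Every common value will do, because the coefficient vanishes.
      obtain ⟨Z, hZ⟩ : ∃ Z : Bt P, ∀ m : List b.support, m.length + 1 = (i :: k).length →
          wordProd P m = wordProd P (i :: k) * s P j → wordY c m = Z := by
        by_cases h : ∃ m : List b.support, m.length + 1 = (i :: k).length ∧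
            wordProd P m = wordProd P (i :: k) * s P j
        · obtain ⟨m, hm, hm'⟩ := h
          exact ⟨wordY c m, fun m' h1 h2 => wordY_congr hcW m' m (by lia)
            (h2.trans hm'.symm)⟩
        · exact ⟨0, fun m h1 h2 => absurd ⟨m, h1, h2⟩ h⟩
      have h1 := DBt_wordY hcW j Z (i :: k) hZ
      rw [posInd_congr h, sub_self, mul_zero, zero_smul] at h1
      exact h1
    · have h2 := len_mul_s_lt_of_changes h
      have h1 := DBt_wordY hcW j 0 (i :: k) (fun m h3 h4 => ih m (by rw [h4]; lia) (by lia))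
      rw [smul_zero] at h1
      exact h1

variable (b c) in
/-- The element `Y_w` of `𝓑̃(V)`, the product of the `c_α⁻¹ [α]` along a reduced decomposition
of `w`. -/
def nilY [P.IsReduced] (w : P.weylGroup) : Bt P := wordY c (exists_reducedWord b w).choose

theorem wordY_eq_nilY [P.IsReduced]
    (hcW : ∀ (w : P.weylGroup) (i : ι), c (w • i) = c i) {l : List b.support} {w : P.weylGroup}
    (h : IsReducedWord b w l) : wordY (P := P) c l = nilY b c w := by
  have h' := (exists_reducedWord b w).choose_spec
  exact wordY_congr hcW _ _ (h.2.trans h'.2.symm) (h.1.trans h'.1.symm)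

/-- `Y_w Y_{w'}` is `Y_{w w'}` if the lengths add up, and zero otherwise. -/
theorem nilY_mul [P.IsReduced]
    (hcW : ∀ (w : P.weylGroup) (i : ι), c (w • i) = c i) (w w' : P.weylGroup) :
    nilY b c w * nilY b c w' =
      if len b (w * w') = len b w + len b w' then nilY b c (w * w') else 0 := by
  obtain ⟨h1, h2⟩ := (exists_reducedWord b w).choose_spec
  obtain ⟨h1', h2'⟩ := (exists_reducedWord b w').choose_spec
  rw [nilY, nilY, ← wordY_append]
  have hprod := wordProd_append (exists_reducedWord b w).choose (exists_reducedWord b w').choose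
  rw [show wordProd P _ = w from h1, show wordProd P _ = w' from h1'] at hprod
  split_ifs with h
  · exact wordY_eq_nilY hcW ⟨hprod, by rw [List.length_append, h2, h2', h]⟩
  · refine wordY_eq_zero hcW _ ?_
    have := len_mul_le (b := b) w w'
    rw [hprod, List.length_append, h2, h2']
    lia

/-- For a positive root `α`, the skew derivative of `Y_w` is `Y_{w s_α}` up to the factor `c_α` if
the length drops by exactly one, and zero otherwise. -/
theorem DBt_nilY [P.IsReduced] (hc : ∀ i, c i ≠ 0)
    (hcW : ∀ (w : P.weylGroup) (i : ι), c (w • i) = c i) (w : P.weylGroup) {j : ι}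
    (hj : b.IsPos j) : c j • DBt P j (nilY b c w) =
      if len b (w * s P j) + 1 = len b w then nilY b c (w * s P j) else 0 := by
  obtain ⟨h1, h2⟩ := (exists_reducedWord b w).choose_spec
  change wordProd P _ = w at h1
  have key : ∀ m : List b.support, m.length + 1 = (exists_reducedWord b w).choose.length →
      wordProd P m = wordProd P (exists_reducedWord b w).choose * s P j → wordY c m =
      if len b (w * s P j) + 1 = len b w then nilY b c (w * s P j) else 0 := by
    intro m hm hm'
    rw [h1] at hm'
    split_ifs with h
    · exact wordY_eq_nilY hcW ⟨hm', by lia⟩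
    · refine wordY_eq_zero hcW m ?_
      have := len_wordProd_le m
      rw [hm'] at this ⊢
      lia
  have h3 := DBt_wordY hcW j _ _ key
  rw [h1] at h3
  rw [nilY, h3, smul_smul, mul_inv_cancel_left₀ (hc j), posInd_of_pos hj]
  by_cases hw : b.IsPos (w • j)
  · have := lt_len_mul_s hj hw
    rw [posInd_of_pos hw, sub_self, zero_smul, if_neg (by lia)]
  · rw [posInd_of_not_pos hw, sub_zero, one_smul]

/-! ### Commutation relations in the double -/

theorem tens_zero_left (y : Bt P) : tens P 0 y = 0 := by
  rw [← zero_smul ℂ (0 : B P), tens_smul_left, zero_smul]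

theorem one_tens_mul_xb_of_homog {g : P.weylGroup} {y : Bt P} {j : ι}
    (hy : Homog P g (ofBt P y))
    (h : tens P 1 y * tens P (xb P j) 1 = tens P (xb P (g • j)) y + tens P 1 (DBt P j y))
    (i : ι) : tens P 1 (yb P i * y) * tens P (xb P j) 1 =
      tens P (xb P ((s P i * g) • j)) (yb P i * y) + tens P 1 (DBt P j (yb P i * y)) := by
  rw [← right_mul, mul_assoc, h, mul_add, cross_mul, cross_mul, DBt_yb_mul hy, dbar_xb, act_xb,
    dbar_one, map_one, one_mul, one_mul, one_mul, one_mul, tens_zero_left, zero_add,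
    tens_add_right, mul_smul, tens_smul_left, tens_smul_right, pr_comm]
  abel

/-- The commutation of `1 ⊗ Y_w` with `[α] ⊗ 1`: apart from moving `[α]` to `[w(α)]` it produces
a skew derivative of `Y_w`. -/
theorem nilY_mul_xb [P.IsReduced] (w : P.weylGroup) (j : ι) :
    tens P 1 (nilY b c w) * tens P (xb P j) 1 =
      tens P (xb P (w • j)) (nilY b c w) + tens P 1 (DBt P j (nilY b c w)) := by
  have key : ∀ l : List b.support, tens P 1 (wordY c l) * tens P (xb P j) 1 =
      tens P (xb P (wordProd P l • j)) (wordY c l) + tens P 1 (DBt P j (wordY c l)) := by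
    intro l
    induction l with
    | nil =>
      have : tens P 1 (0 : Bt P) = 0 := by
        rw [← zero_smul ℂ (0 : Bt P), tens_smul_right, zero_smul]
      rw [wordY_nil, left_mul, one_mul, wordProd_nil, one_smul, DBt_one, this, add_zero]
    | cons i l ih =>
      have h := one_tens_mul_xb_of_homog (homog_wordY l) ih i.1
      rw [wordY_cons, wordProd_cons, map_smul, tens_smul_right, tens_smul_right, tens_smul_right,
        smul_mul_assoc, h, smul_add]
  have h := key (exists_reducedWord b w).choose
  rwa [show wordProd P _ = w from (exists_reducedWord b w).choose_spec.1] at h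

/-! ### The bijection behind the cancellation of quantum corrections -/

theorem s_mul_cancel_left (i : ι) (w : P.weylGroup) : s P i * (s P i * w) = w := by
  rw [← mul_assoc, s_mul_self, one_mul]

theorem pairing_s_smul_eq (j i k : ι) : P.pairingIn ℤ (s P j • i) k =
    P.pairingIn ℤ i k - P.pairingIn ℤ i j * P.pairingIn ℤ j k := by
  have hinj : Function.Injective (algebraMap ℤ ℂ) := FaithfulSMul.algebraMap_injective ℤ ℂ
  apply hinj
  rw [map_sub, map_mul, P.algebraMap_pairingIn, P.algebraMap_pairingIn, P.algebraMap_pairingIn,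
    ← P.root_coroot_eq_pairing, root_s_smul, map_sub, LinearMap.sub_apply,
    P.root_coroot_eq_pairing, ← P.algebraMap_pairingIn ℤ i j, map_zsmul, LinearMap.smul_apply,
    P.root_coroot_eq_pairing, ← P.algebraMap_pairingIn ℤ j k]
  simp

variable (b)

/-- The pairs `(β, γ)` that contribute to the commutators of a classical with a quantum term:
`β ∈ Δ̃_+`, and `s_β s_γ` has length one less than `s_β`. -/
structure DescentPair (β γ : ι) : Prop where
  tilde : IsTilde b β
  pos : b.IsPos γ
  ne : γ ≠ β
  len_eq : len b (s P β * s P γ) + 1 = len b (s P β)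

/-- The pairs `(α_1, α_2)` of roots in `Δ̃_+` at an obtuse angle that contribute to the
commutators of two quantum terms: the lengths of `s_{α_1}` and `s_{α_2}` add up in the product. -/
structure ObtusePair (i j : ι) : Prop where
  tilde_left : IsTilde b i
  tilde_right : IsTilde b j
  obtuse : P.pairingIn ℤ i j < 0
  len_eq : len b (s P i * s P j) = len b (s P i) + len b (s P j)

variable {b}

theorem pairing_mem_of_isPos [P.IsReduced] {i j : ι} (hi : b.IsPos i) (hj : b.IsPos j)
    (hij : i ≠ j) : (P.pairingIn ℤ i j, P.pairingIn ℤ j i) ∈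
      ({(0, 0), (1, 1), (-1, -1), (1, 2), (2, 1), (-1, -2), (-2, -1), (1, 3), (3, 1), (-1, -3),
        (-3, -1)} : Set (ℤ × ℤ)) := by
  refine P.pairingIn_pairingIn_mem_set_of_isCrystal_of_isRed' i j
    (fun h => hij (P.root.injective h)) (fun h => ?_)
  rw [← root_neg] at h
  rw [P.root.injective h] at hi
  exact isPos_neg.1 hi hj

/-- `γ` is an inversion of `s_β`, because `s_β s_γ` is shorter than `s_β`. -/
theorem DescentPair.not_isPos [P.IsReduced] {β γ : ι} (h : DescentPair b β γ) :
    ¬ b.IsPos (s P β • γ) := by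
  intro h'
  have := lt_len_mul_s h.pos h'
  have := h.len_eq
  lia

theorem DescentPair.pairing_eq_one [P.IsReduced] {β γ : ι} (h : DescentPair b β γ) :
    P.pairingIn ℤ γ β = 1 :=
  pairing_eq_one_of_isTilde h.tilde h.pos h.not_isPos h.ne

/-- The exceptional configuration, which occurs for the highest root `β` of `G_2` only: with
`γ' = β - γ`, if `γ - γ'` is positive and `s_γ β`, `s_γ' β` are negative, then `s_β s_γ'` is too
short for a descent from `s_β`. -/
theorem len_mul_s_add_three_le [P.IsReduced] {β γ γ' : ι} (hγ' : γ' = neg P (s P β • γ))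
    (hβ : b.IsPos β) (hγ : b.IsPos γ) (h1 : b.IsPos (s P γ' • γ))
    (h2 : ¬ b.IsPos (s P γ' • β)) (h3 : ¬ b.IsPos (s P γ • β)) :
    len b (s P β * s P γ') + 3 ≤ len b (s P β) := by
  have hs : s P γ' = s P β * (s P γ * s P β) := by
    rw [hγ', s_neg, s_smul, s_inv, mul_assoc]
  -- The chain `s_β s_γ' < s_γ' < s_γ s_γ' < s_β` for the Bruhat order: each step is the right
  -- multiplication by a reflection, and increases the length.
  have e1 : s P β * s P γ' * s P (neg P (s P γ' • β)) = s P γ' := by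
    rw [s_neg, s_smul, s_inv]
    simp only [mul_assoc, s_mul_cancel_left]
  have e2 : s P γ' * s P (s P γ' • γ) = s P γ * s P γ' := by
    rw [s_smul, s_inv]
    simp only [mul_assoc, s_mul_cancel_left]
  have e3 : s P γ * s P γ' * s P (neg P (s P γ' • β)) = s P β := by
    rw [s_neg, s_smul, s_inv]
    simp only [mul_assoc, s_mul_cancel_left]
    rw [hs]
    simp only [s_mul_cancel_left]
  have l1 := lt_len_mul_s (w := s P β * s P γ') (isPos_neg.2 h2) (by
    rw [smul_neg, mul_smul, smul_s_smul, s_smul_self, neg_neg]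
    exact hβ)
  have l2 := lt_len_mul_s (w := s P γ') h1 (by rwa [smul_s_smul])
  have l3 := lt_len_mul_s (w := s P γ * s P γ') (isPos_neg.2 h2) (by
    rw [smul_neg, mul_smul, smul_s_smul]
    exact isPos_neg.2 h3)
  rw [e1] at l1
  rw [e2] at l2
  rw [e3] at l3
  lia

/-- For a pair `(β, γ)` as above, the roots `β`, `γ`, `β - γ` lie in a root system of rank two in
which `s_γ β` or `s_{β - γ} β` is positive. Only for type `G_2` both could be negative, and then
the length of `s_β s_γ` is too small. -/
theorem DescentPair.isPos_or [P.IsReduced] {β γ : ι} (h : DescentPair b β γ) :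
    b.IsPos (s P γ • β) ∨ b.IsPos (s P (neg P (s P β • γ)) • β) := by
  by_contra! hneg
  obtain ⟨h1, h2⟩ := hneg
  obtain ⟨γ', hγ'⟩ : ∃ γ', γ' = neg P (s P β • γ) := ⟨_, rfl⟩
  rw [← hγ'] at h2
  have hγ : γ = neg P (s P β • γ') := by
    rw [hγ', smul_neg, neg_neg, smul_s_smul]
  have hpos' : b.IsPos γ' := hγ' ▸ isPos_neg.2 h.not_isPos
  have hp := h.pairing_eq_one
  have hβ := h.tilde.1
  have hβγ' : P.pairingIn ℤ β γ' = P.pairingIn ℤ β γ := by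
    rw [hγ', pairing_neg_right, pairing_s_smul_right, _root_.neg_neg]
  have hH : b.height γ' = b.height β - b.height γ := by
    rw [hγ', height_neg, height_s_smul, hp]
    ring
  have ha : b.height (s P γ' • γ) = b.height γ - b.height γ' * (P.pairingIn ℤ β γ - 2) := by
    have e : P.pairingIn ℤ γ (s P β • γ) = 2 - P.pairingIn ℤ β γ := by
      rw [← pairing_s_smul β, smul_s_smul, pairing_s_smul_eq, hp, pairing_self, one_mul]
    rw [height_s_smul, hγ', pairing_neg_right, e]
    ring
  have ha' : b.height (s P γ • γ') = b.height γ' - b.height γ * (P.pairingIn ℤ β γ - 2) := by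
    have e : P.pairingIn ℤ (s P β • γ) γ = 2 - P.pairingIn ℤ β γ := by
      rw [pairing_s_smul_eq, hp, pairing_self, one_mul]
    rw [height_s_smul, hγ', pairing_neg_left, e]
    ring
  have ne1 := b.height_ne_zero (s P γ' • γ)
  have hlen := h.len_eq
  have h1' := h1
  have h2' := h2
  have hγpos := h.pos
  rw [b.isPos_iff, height_s_smul] at h1' h2'
  rw [hβγ'] at h2'
  rw [b.isPos_iff] at hγpos
  have hpos2 := hpos'
  rw [b.isPos_iff] at hpos2
  have hmem := pairing_mem_of_isPos hβ h.pos h.ne.symm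
  rw [hp] at hmem
  simp only [Set.mem_insert_iff, Set.mem_singleton_iff, Prod.mk.injEq] at hmem
  have hn : P.pairingIn ℤ β γ = 3 := by
    have hn : P.pairingIn ℤ β γ = 1 ∨ P.pairingIn ℤ β γ = 2 ∨ P.pairingIn ℤ β γ = 3 := by
      lia
    rcases hn with hn | hn | hn
    · rw [hn] at h1'; lia
    · have := b.height_ne_zero (s P γ • β)
      rw [height_s_smul, hn] at this
      rw [hn] at h1' h2'
      lia
    · exact hn
  rw [hn] at ha ha'
  have hs : s P β * s P γ = s P γ' * s P β := by
    rw [hγ', s_neg, s_smul, s_inv, mul_assoc, s_mul_self, mul_one]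
  rcases lt_or_gt_of_ne (show b.height γ' ≠ b.height γ by lia) with hlt | hlt
  · have := len_mul_s_add_three_le hγ' hβ h.pos (b.isPos_iff.2 (by lia)) h2 h1
    have e : len b (s P β * s P γ) = len b (s P β * s P γ') := by
      rw [hs, ← len_inv, mul_inv_rev, s_inv, s_inv]
    lia
  · have := len_mul_s_add_three_le hγ hβ hpos' (b.isPos_iff.2 (by lia)) h1 h2
    lia

open Classical in
variable (b) in
/-- The map from pairs `(β, γ)` to pairs `(α_1, α_2)` with `s_{α_1} s_{α_2} = s_β s_γ` and
`α_1^∨ + α_2^∨ = β^∨`. -/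
def toObtuse (p : ι × ι) : ι × ι :=
  if b.IsPos (s P p.2 • p.1) then (p.2, s P p.2 • p.1)
  else (s P (neg P (s P p.1 • p.2)) • p.1, neg P (s P p.1 • p.2))

variable (P) in
/-- The map from pairs `(α_1, α_2)` to pairs `(β, γ)` with `s_{α_1} s_{α_2} = s_β s_γ` and
`α_1^∨ + α_2^∨ = β^∨`. -/
def toDescent (p : ι × ι) : ι × ι :=
  if P.pairingIn ℤ p.1 p.2 = -1 then (s P p.1 • p.2, p.1)
  else (s P p.2 • p.1, s P p.2 • s P p.1 • p.2)

theorem s_mul_s_first (i j : ι) : s P (s P i • j) * s P i = s P i * s P j := by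
  rw [s_smul, inv_mul_cancel_right]

theorem s_mul_s_second (i j : ι) :
    s P (s P j • i) * s P (s P j • s P i • j) = s P i * s P j := by
  simp only [s_smul, s_inv, mul_assoc, s_mul_cancel_left]

theorem coroot_first {i j : ι} (h : P.pairingIn ℤ i j = -1) :
    P.coroot (s P i • j) = P.coroot i + P.coroot j := by
  rw [coroot_s_smul, h, neg_one_smul, sub_neg_eq_add, add_comm]

theorem coroot_second {i j : ι} (h : P.pairingIn ℤ j i = -1) :
    P.coroot (s P j • i) = P.coroot i + P.coroot j := by
  rw [coroot_first h, add_comm]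

theorem coht_eq_add {i j k : ι} (h : P.coroot k = P.coroot i + P.coroot j) :
    coht b k = coht b i + coht b j := by
  rw [coht_add_zsmul (i := i) (j := j) (z := 1) (by rw [h, one_smul]), one_mul]

theorem ObtusePair.pairing_cases [P.IsReduced] {i j : ι} (h : ObtusePair b i j) :
    P.pairingIn ℤ i j = -1 ∧ P.pairingIn ℤ j i ≤ -1 ∨
      P.pairingIn ℤ j i = -1 ∧ (P.pairingIn ℤ i j = -2 ∨ P.pairingIn ℤ i j = -3) := by
  have hne : i ≠ j := by
    intro e
    have := h.obtuse
    rw [e, pairing_self] at this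
    lia
  have hmem := pairing_mem_of_isPos h.tilde_left.1 h.tilde_right.1 hne
  have := h.obtuse
  simp only [Set.mem_insert_iff, Set.mem_singleton_iff, Prod.mk.injEq] at hmem
  rcases hmem with h | h | h | h | h | h | h | h | h | h | h <;> lia

/-- All inequalities between the lengths are sharp: `2 ht(β^∨) - 1` is both an upper bound for the
length of `s_β` and the sum of the lengths of `s_{α_1}` and `s_{α_2}`, plus one. -/
theorem ObtusePair.descentPair_of [P.IsReduced] {i j β γ : ι} (h : ObtusePair b i j)
    (hcoroot : P.coroot β = P.coroot i + P.coroot j) (hs : s P β * s P γ = s P i * s P j)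
    (hβ : b.IsPos β) (hγ : b.IsPos γ) (hinv : ¬ b.IsPos (s P β • γ))
    (hp : P.pairingIn ℤ γ β = 1) : DescentPair b β γ := by
  have h1 := len_mul_s_lt hγ hinv
  have h2 := len_s_le hβ
  have h3 := h.tilde_left.2
  have h4 := h.tilde_right.2
  have h5 := h.len_eq
  rw [coht_eq_add hcoroot] at h2
  rw [hs] at h1
  refine ⟨⟨hβ, ?_⟩, hγ, ?_, ?_⟩
  · rw [coht_eq_add hcoroot]
    lia
  · rintro rfl
    rw [pairing_self] at hp
    lia
  · rw [hs]
    lia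

theorem DescentPair.obtusePair_of [P.IsReduced] {i j β γ : ι} (h : DescentPair b β γ)
    (hcoroot : P.coroot β = P.coroot i + P.coroot j) (hs : s P β * s P γ = s P i * s P j)
    (hi : b.IsPos i) (hj : b.IsPos j) (hp : P.pairingIn ℤ i j < 0) : ObtusePair b i j := by
  have h1 := len_s_le hi
  have h2 := len_s_le hj
  have h3 := h.tilde.2
  have h4 := len_mul_le (b := b) (s P i) (s P j)
  have h5 := h.len_eq
  rw [coht_eq_add hcoroot] at h3
  rw [hs] at h5
  exact ⟨⟨hi, by lia⟩, ⟨hj, by lia⟩, hp, by lia⟩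

theorem height_second {i j : ι} (h : P.pairingIn ℤ j i = -1) :
    b.height (s P j • s P i • j) =
      b.height i - (P.pairingIn ℤ i j + 1) * b.height j := by
  rw [height_s_smul, height_s_smul, pairing_s_smul_eq, h, pairing_self]
  ring

theorem pairing_second {i j : ι} (h : P.pairingIn ℤ j i = -1) :
    P.pairingIn ℤ (s P j • s P i • j) (s P j • i) = 1 := by
  rw [pairing_s_smul, pairing_s_smul_left, h, _root_.neg_neg]

theorem ObtusePair.toDescent [P.IsReduced] {i j : ι} (h : ObtusePair b i j) :
    DescentPair b (toDescent P (i, j)).1 (toDescent P (i, j)).2 := by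
  have hi := h.tilde_left.1
  have hj := h.tilde_right.1
  have hi' := b.isPos_iff.1 hi
  have hj' := b.isPos_iff.1 hj
  by_cases h1 : P.pairingIn ℤ i j = -1
  · have h2 : P.pairingIn ℤ j i ≤ -1 := by
      have := h.pairing_cases
      lia
    have hp : P.pairingIn ℤ i (s P i • j) = 1 := by
      rw [pairing_s_smul_right, h1, _root_.neg_neg]
    rw [RootNichols.toDescent, if_pos h1]
    refine h.descentPair_of (coroot_first h1) (s_mul_s_first i j) ?_ hi ?_ hp
    · rw [b.isPos_iff, height_s_smul]
      nlinarith
    · rw [b.isPos_iff, height_s_smul, hp, height_s_smul]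
      nlinarith
  · have h2 : P.pairingIn ℤ j i = -1 ∧ (P.pairingIn ℤ i j = -2 ∨ P.pairingIn ℤ i j = -3) := by
      have := h.pairing_cases
      lia
    have hp := pairing_second h2.1
    rw [RootNichols.toDescent, if_neg h1]
    refine h.descentPair_of (coroot_second h2.1) (s_mul_s_second i j) ?_ ?_ ?_ hp
    · rw [b.isPos_iff, height_s_smul]
      obtain ⟨-, h2 | h2⟩ := h2 <;> rw [h2] <;> lia
    · rw [b.isPos_iff, height_second h2.1]
      obtain ⟨-, h2 | h2⟩ := h2 <;> rw [h2] <;> lia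
    · rw [b.isPos_iff, height_s_smul, hp, height_second h2.1, height_s_smul]
      lia

theorem DescentPair.pairing_pos [P.IsReduced] {β γ : ι} (h : DescentPair b β γ) :
    0 < P.pairingIn ℤ β γ := by
  rw [P.zero_lt_pairingIn_iff', h.pairing_eq_one]
  exact one_pos

theorem DescentPair.toObtuse [P.IsReduced] {β γ : ι} (h : DescentPair b β γ) :
    ObtusePair b (toObtuse b (β, γ)).1 (toObtuse b (β, γ)).2 := by
  have hp := h.pairing_eq_one
  by_cases h1 : b.IsPos (s P γ • β)
  · have h2 : P.pairingIn ℤ γ (s P γ • β) = -1 := by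
      rw [pairing_s_smul_right, hp]
    rw [RootNichols.toObtuse, if_pos h1]
    refine h.obtusePair_of ?_ ?_ h.pos h1 (by rw [h2]; lia)
    · rw [← coroot_first h2, smul_s_smul]
    · have := s_mul_s_first (P := P) γ (s P γ • β)
      rwa [smul_s_smul] at this
  · have h2 := h.isPos_or.resolve_left h1
    rw [RootNichols.toObtuse, if_neg h1]
    have h3 := h.pairing_pos
    obtain ⟨γ', hγ'⟩ : ∃ γ', γ' = neg P (s P β • γ) := ⟨_, rfl⟩
    have hpos' : b.IsPos γ' := hγ' ▸ isPos_neg.2 h.not_isPos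
    have h4 : P.pairingIn ℤ γ' (s P γ' • β) = -1 := by
      rw [pairing_s_smul_right, hγ', pairing_neg_left, pairing_s_smul_left, hp, _root_.neg_neg]
    have hs : s P γ' * s P β = s P β * s P γ := by
      rw [hγ', s_neg, s_smul, inv_mul_cancel_right]
    simp only [← hγ'] at h2 ⊢
    refine h.obtusePair_of ?_ ?_ h2 hpos' ?_
    · rw [← coroot_second h4, smul_s_smul]
    · rw [s_smul, s_inv, mul_assoc, s_mul_self, mul_one, hs]
    · rw [pairing_s_smul_left, hγ', pairing_neg_right, pairing_s_smul_right, _root_.neg_neg]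
      lia

theorem ObtusePair.toObtuse_toDescent [P.IsReduced] {i j : ι} (h : ObtusePair b i j) :
    RootNichols.toObtuse b (RootNichols.toDescent P (i, j)) = (i, j) := by
  have hi := h.tilde_left.1
  have hj := h.tilde_right.1
  have hi' := b.isPos_iff.1 hi
  have hj' := b.isPos_iff.1 hj
  by_cases h1 : P.pairingIn ℤ i j = -1
  · rw [RootNichols.toDescent, if_pos h1, RootNichols.toObtuse, if_pos]
    · simp only [smul_s_smul]
    · simpa only [smul_s_smul] using hj
  · have h2 : P.pairingIn ℤ j i = -1 ∧ (P.pairingIn ℤ i j = -2 ∨ P.pairingIn ℤ i j = -3) := by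
      have := h.pairing_cases
      lia
    have e : neg P (s P (s P j • i) • s P j • s P i • j) = j := by
      rw [s_smul, s_inv, mul_smul, mul_smul, smul_s_smul, smul_s_smul, s_smul_self, neg_neg]
    rw [RootNichols.toDescent, if_neg h1, RootNichols.toObtuse, if_neg]
    · simp only [e, smul_s_smul]
    · rw [b.isPos_iff, height_s_smul, height_second h2.1, height_s_smul, pairing_s_smul,
        pairing_s_smul_right]
      obtain ⟨-, h2 | h2⟩ := h2 <;> rw [h2] <;> lia

theorem DescentPair.toDescent_toObtuse [P.IsReduced] {β γ : ι} (h : DescentPair b β γ) :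
    RootNichols.toDescent P (RootNichols.toObtuse b (β, γ)) = (β, γ) := by
  have hp := h.pairing_eq_one
  by_cases h1 : b.IsPos (s P γ • β)
  · have h2 : P.pairingIn ℤ γ (s P γ • β) = -1 := by
      rw [pairing_s_smul_right, hp]
    rw [RootNichols.toObtuse, if_pos h1, RootNichols.toDescent, if_pos h2]
    simp only [smul_s_smul]
  · rw [RootNichols.toObtuse, if_neg h1]
    obtain ⟨γ', hγ'⟩ : ∃ γ', γ' = neg P (s P β • γ) := ⟨_, rfl⟩
    have hpos' : b.IsPos γ' := hγ' ▸ isPos_neg.2 h.not_isPos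
    simp only [← hγ']
    rw [RootNichols.toDescent, if_neg]
    · have e : s P (s P γ' • β) • γ' = s P γ' • γ := by
        have e' : s P β • neg P γ' = γ := by rw [hγ', neg_neg, smul_s_smul]
        rw [s_smul, s_inv, mul_smul, mul_smul, s_smul_self, e']
      simp only [e, smul_s_smul]
    · rw [pairing_s_smul_left]
      intro h3
      rw [hγ', pairing_neg_right, pairing_s_smul_right] at h3
      apply h1
      have h4 : b.height γ' = b.height β - b.height γ := by
        rw [hγ', height_neg, height_s_smul, hp]
        ring
      rw [b.isPos_iff] at hpos' ⊢
      rw [height_s_smul]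
      have h5 : P.pairingIn ℤ β γ = 1 := by lia
      rw [h5]
      lia

/-! ### The alternating form -/

variable (P) in
/-- The value `(x, α) (y, β) - (y, α) (x, β)` for the roots `α`, `β` with indices `i`, `j`. -/
def wedge (x y : N) (i j : ι) : ℂ :=
  P.toLinearMap (P.root i) x * P.toLinearMap (P.root j) y -
    P.toLinearMap (P.root i) y * P.toLinearMap (P.root j) x

theorem wedge_swap (x y : N) (i j : ι) : wedge P x y i j = -wedge P x y j i := by
  unfold wedge
  ring

theorem wedge_self (x y : N) (i : ι) : wedge P x y i i = 0 := by
  unfold wedge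
  ring

theorem wedge_neg_left (x y : N) (i j : ι) : wedge P x y (neg P i) j = -wedge P x y i j := by
  unfold wedge
  rw [root_neg, map_neg, LinearMap.neg_apply, LinearMap.neg_apply]
  ring

theorem wedge_neg_right (x y : N) (i j : ι) : wedge P x y i (neg P j) = -wedge P x y i j := by
  rw [wedge_swap, wedge_neg_left, wedge_swap, _root_.neg_neg]

theorem wedge_s_smul_left (x y : N) (i j k : ι) : wedge P x y (s P k • i) j =
    wedge P x y i j - P.pairingIn ℤ i k * wedge P x y k j := by
  have h : ∀ z, P.toLinearMap (P.root (s P k • i)) z = P.toLinearMap (P.root i) z -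
      P.pairingIn ℤ i k * P.toLinearMap (P.root k) z := by
    intro z
    rw [root_s_smul, map_sub, map_zsmul]
    simp
  unfold wedge
  rw [h, h]
  ring

theorem wedge_s_smul_right (x y : N) (i j k : ι) : wedge P x y i (s P k • j) =
    wedge P x y i j - P.pairingIn ℤ j k * wedge P x y i k := by
  rw [wedge_swap, wedge_s_smul_left, wedge_swap x y j, wedge_swap x y k]
  ring

theorem ObtusePair.wedge_toDescent [P.IsReduced] (x y : N) {i j : ι} (h : ObtusePair b i j) :
    wedge P x y (RootNichols.toDescent P (i, j)).2 (RootNichols.toDescent P (i, j)).1 =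
      wedge P x y i j := by
  by_cases h1 : P.pairingIn ℤ i j = -1
  · rw [RootNichols.toDescent, if_pos h1, wedge_s_smul_right, wedge_self, mul_zero, sub_zero]
  · have h2 : P.pairingIn ℤ j i = -1 := by
      have := h.pairing_cases
      lia
    rw [RootNichols.toDescent, if_neg h1]
    simp only [wedge_s_smul_left, wedge_s_smul_right, pairing_s_smul_eq, wedge_self, h2,
      pairing_self]
    rw [wedge_swap x y j i]
    push_cast
    ring

theorem s_mul_toDescent (i j : ι) :
    s P (toDescent P (i, j)).1 * s P (toDescent P (i, j)).2 =
      s P i * s P j := by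
  unfold toDescent
  split_ifs
  · exact s_mul_s_first i j
  · exact s_mul_s_second i j

theorem ObtusePair.qmon_toDescent [P.IsReduced] {i j : ι} (h : ObtusePair b i j) :
    qmon b i * qmon b j = qmon b (RootNichols.toDescent P (i, j)).1 := by
  refine qmon_mul h.tilde_left.1 h.tilde_right.1 ?_
  unfold RootNichols.toDescent
  split_ifs with h1
  · exact coroot_first h1
  · have h2 : P.pairingIn ℤ j i = -1 := by
      have := h.pairing_cases
      simp only at h1
      lia
    exact coroot_second h2

/-- If the lengths of `s_α` and `s_β` add up in the product and `α ≠ β`, then the angle between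
`α` and `β` is not acute. -/
theorem pairing_nonpos_of_len_eq [P.IsReduced] {i j : ι} (hi : b.IsPos i) (hj : b.IsPos j)
    (hlen : len b (s P i * s P j) = len b (s P i) + len b (s P j)) :
    P.pairingIn ℤ i j ≤ 0 := by
  by_contra! h
  have h' := (P.zero_lt_pairingIn_iff' (S := ℤ)).1 h
  have h1 : b.IsPos (s P i • j) := by
    by_contra h1
    have := len_mul_s_lt hj h1
    lia
  have h2 : b.IsPos (s P j • i) := by
    by_contra h2
    have h3 := len_mul_s_lt hi h2
    rw [← len_inv, mul_inv_rev, s_inv, s_inv] at h3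
    lia
  rw [b.isPos_iff] at hi hj h1 h2
  rw [height_s_smul] at h1 h2
  nlinarith

/-! ### Sums over roots -/

variable (b) in
/-- The finite set of positive roots. -/
def posRoots : Finset ι := (Set.toFinite {i | b.IsPos i}).toFinset

theorem mem_posRoots {i : ι} : i ∈ posRoots b ↔ b.IsPos i := by simp [posRoots]

/-- A sum over all roots of a function that does not see signs is twice the sum over the
positive roots. -/
theorem sum_posRoots [Fintype ι] {E : Type*} [AddCommGroup E] (f : ι → E)
    (hf : ∀ i, f (neg P i) = f i) : ∑ i, f i = ∑ i ∈ posRoots b, f i + ∑ i ∈ posRoots b, f i := by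
  classical
  rw [← Finset.sum_filter_add_sum_filter_not Finset.univ (fun i => b.IsPos i) f]
  have h1 : Finset.univ.filter (fun i => b.IsPos i) = posRoots b := by
    ext i
    simp [mem_posRoots]
  rw [h1]
  congr 1
  refine Finset.sum_nbij' (neg P) (neg P) ?_ ?_ ?_ ?_ ?_
  · intro i hi
    rw [Finset.mem_filter] at hi
    exact mem_posRoots.2 (isPos_neg.2 hi.2)
  · intro i hi
    rw [Finset.mem_filter, isPos_neg, not_not]
    exact ⟨Finset.mem_univ _, mem_posRoots.1 hi⟩
  · intro i _; exact neg_neg P i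
  · intro i _; exact neg_neg P i
  · intro i _; exact (hf i).symm

theorem eq_zero_of_add_self {E : Type*} [AddCommGroup E] [Module ℂ E] {z : E} (h : z + z = 0) :
    z = 0 := by
  rw [← two_smul ℂ] at h
  exact (smul_eq_zero.1 h).resolve_left two_ne_zero

theorem sum_pr_smul [Fintype ι] {E : Type*} [AddCommGroup E] [Module ℂ E] (k : ι) (g : ι → E)
    (hg : ∀ i, g (neg P i) = -g i) : ∑ i, pr P k i • g i = g k + g k := by
  classical
  have h : ∀ i, pr P k i • g i = (if k = i then g i else 0) - (if neg P k = i then g i else 0) := by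
    intro i
    unfold pr
    rw [if_congr (neg_eq_iff (P := P) (i := k) (j := i)) rfl rfl, sub_smul, ite_smul, ite_smul,
      one_smul, zero_smul]
  simp only [h, Finset.sum_sub_distrib, Finset.sum_ite_eq, Finset.mem_univ, if_true]
  rw [hg, sub_neg_eq_add]

theorem c_neg (hcW : ∀ (w : P.weylGroup) (i : ι), c (w • i) = c i) (i : ι) :
    c (neg P i) = c i := by
  rw [← s_smul_self, hcW]

theorem sum_s_smul [Fintype ι] {E : Type*} [AddCommMonoid E] (k : ι) (f : ι → E) :
    ∑ i, f (s P k • i) = ∑ i, f i :=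
  Equiv.sum_comp (MulAction.toPerm (s P k) : Equiv.Perm ι) f

/-- The classical relations: they hold because all skew derivations vanish on the left-hand side. -/
theorem sum_wedge_mul_eq_zero (hcW : ∀ (w : P.weylGroup) (i : ι), c (w • i) = c i) (x y : N) :
    ∑ i ∈ posRoots b, ∑ j ∈ posRoots b,
      (wedge P x y i j * (c i * c j)) • (xb P i * xb P j) = 0 := by
  have := Fintype.ofFinite ι
  have hfull : ∑ i, ∑ j, (wedge P x y i j * (c i * c j)) • (xb P i * xb P j) = 0 := by
    apply eq_zero_of_DB_eq_zero
    · simp only [map_sum, map_smul, counitB_mul, counitB_xb, mul_zero, smul_zero,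
        Finset.sum_const_zero]
    · intro k
      have h1 : ∀ i j, DB P k ((wedge P x y i j * (c i * c j)) • (xb P i * xb P j)) =
          pr P k j • ((wedge P x y i j * (c i * c j)) • xb P i) +
            pr P k i • ((wedge P x y i j * (c i * c j)) • xb P (s P k • j)) := by
        intro i j
        rw [map_smul, DB_mul, DB_xb, DB_xb, act_xb, mul_smul_comm, mul_one, smul_mul_assoc,
          one_mul, smul_add, smul_comm, smul_comm (pr P k i)]
      simp only [map_sum, h1, Finset.sum_add_distrib]
      have h2 : ∑ i, ∑ j, pr P k j • ((wedge P x y i j * (c i * c j)) • xb P i) =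
          ∑ i, (((wedge P x y i k * (c i * c k)) • xb P i) +
            ((wedge P x y i k * (c i * c k)) • xb P i)) := by
        refine Finset.sum_congr rfl fun i _ => ?_
        refine sum_pr_smul k (fun j => (wedge P x y i j * (c i * c j)) • xb P i) fun j => ?_
        rw [wedge_neg_right, c_neg hcW, neg_mul, neg_smul]
      have h3 : ∑ i, ∑ j, pr P k i • ((wedge P x y i j * (c i * c j)) • xb P (s P k • j)) =
          ∑ j, (((wedge P x y k j * (c k * c j)) • xb P j) +
            ((wedge P x y k j * (c k * c j)) • xb P j)) := by
        rw [Finset.sum_comm, ← sum_s_smul (P := P) k]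
        refine Finset.sum_congr rfl fun j _ => ?_
        rw [smul_s_smul, hcW, sum_pr_smul (P := P) k
          (fun i => (wedge P x y i (s P k • j) * (c i * c j)) • xb P j),
          wedge_s_smul_right, wedge_self, mul_zero, sub_zero]
        intro i
        rw [wedge_neg_left, c_neg hcW, neg_mul, neg_smul]
      rw [h2, h3, ← Finset.sum_add_distrib]
      refine Finset.sum_eq_zero fun i _ => ?_
      rw [wedge_swap x y k i, mul_comm (c k), neg_mul, neg_smul]
      abel
  have hj : ∀ i, ∑ j, (wedge P x y i j * (c i * c j)) • (xb P i * xb P j) =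
      ∑ j ∈ posRoots b, (wedge P x y i j * (c i * c j)) • (xb P i * xb P j) +
      ∑ j ∈ posRoots b, (wedge P x y i j * (c i * c j)) • (xb P i * xb P j) := by
    intro i
    apply sum_posRoots
    intro j
    rw [wedge_neg_right, c_neg hcW, xb_neg, mul_neg, neg_mul, neg_smul, _root_.smul_neg,
      _root_.neg_neg]
  rw [Finset.sum_congr rfl fun i _ => hj i, Finset.sum_add_distrib] at hfull
  have h4 := eq_zero_of_add_self hfull
  rw [sum_posRoots (b := b)] at h4
  · exact eq_zero_of_add_self h4
  · intro i
    refine Finset.sum_congr rfl fun j _ => ?_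
    rw [wedge_neg_left, c_neg hcW, xb_neg, neg_mul, neg_mul, neg_smul, _root_.smul_neg,
      _root_.neg_neg]

/-- Conjugating the classical terms past a quantum correction of degree `s_β` does not change their
sum, because the alternating form `(x ∧ y)(α, β)` is unchanged if `α` is replaced by `s_β α`. -/
theorem sum_wedge_sub_eq_zero (hcW : ∀ (w : P.weylGroup) (i : ι), c (w • i) = c i) (x y : N)
    (j : ι) : ∑ i ∈ posRoots b,
      (wedge P x y i j * c i) • (xb P i - xb P (s P j • i)) = 0 := by
  have := Fintype.ofFinite ι
  have h := sum_posRoots (b := b)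
    (fun i => (wedge P x y i j * c i) • (xb P i - xb P (s P j • i))) (fun i => by
      rw [wedge_neg_left, c_neg hcW, smul_neg, xb_neg, xb_neg, neg_mul, neg_smul, ← _root_.smul_neg,
        neg_sub, sub_neg_eq_add, neg_add_eq_sub])
  have h2 : ∑ i, (wedge P x y i j * c i) • xb P (s P j • i) =
      ∑ i, (wedge P x y i j * c i) • xb P i := by
    rw [← sum_s_smul (P := P) j (fun i => (wedge P x y i j * c i) • xb P i)]
    refine Finset.sum_congr rfl fun i _ => ?_
    rw [wedge_s_smul_left, wedge_self, mul_zero, sub_zero, hcW]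
  simp only [smul_sub, Finset.sum_sub_distrib, h2, sub_self] at h ⊢
  exact eq_zero_of_add_self h.symm

/-! ### The commutator of the quantized elements -/

open Classical in
variable (b) in
/-- The coefficient `q^{α^∨}` of the quantum correction, which is zero for roots outside `Δ̃_+`. -/
def qcoef (i : ι) : QRing b := if IsTilde b i then qmon b i else 0

variable (b c) in
/-- The element `f ⊗ 1 ⊗ Y_w`. -/
def qY [P.IsReduced] (f : QRing b) (w : P.weylGroup) : HR b := f ⊗ₜ[ℂ] tens P 1 (nilY b c w)

theorem tens_zero_right (x : B P) : tens P x 0 = 0 := by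
  rw [← zero_smul ℂ (0 : Bt P), tens_smul_right, zero_smul]

theorem qbr_eq [P.IsReduced] (hcW : ∀ (w : P.weylGroup) (i : ι), c (w • i) = c i)
    {word : ι → List b.support} (hword : ∀ i, IsTilde b i → IsReducedWord b (s P i) (word i))
    (i : ι) : qbr b c word i =
      (1 : QRing b) ⊗ₜ[ℂ] (c i • tens P (xb P i) 1) + qY b c (qcoef b i) (s P i) := by
  unfold qbr qcoef qY
  congr 1
  split_ifs with h
  · rw [← wordY_eq_nilY hcW (hword i h), wordY_eq, tens_smul_right, TensorProduct.smul_tmul]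
  · rw [TensorProduct.zero_tmul]

-- The two identities below restate library lemmas on `HR b`; `rw` and `simp` do not unify the additive
-- structure of the tensor product with that of the ring `HR b` by themselves.
theorem HR_neg_smul (r : ℂ) (z : HR b) : (-r) • z = -(r • z) := neg_smul r z

theorem HR_sub_smul (r t : ℂ) (z : HR b) : (r - t) • z = r • z - t • z := sub_smul r t z

theorem qY_zero [P.IsReduced] (w : P.weylGroup) : qY b c 0 w = 0 := TensorProduct.zero_tmul _ _

theorem qY_mul_qY [P.IsReduced] (hcW : ∀ (w : P.weylGroup) (i : ι), c (w • i) = c i)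
    (f g : QRing b) (w w' : P.weylGroup) : qY b c f w * qY b c g w' =
      if len b (w * w') = len b w + len b w' then qY b c (f * g) (w * w') else 0 := by
  unfold qY
  rw [Algebra.TensorProduct.tmul_mul_tmul, right_mul, nilY_mul hcW]
  split_ifs
  · rfl
  · rw [tens_zero_right, TensorProduct.tmul_zero]

theorem commutator_qY [P.IsReduced] (hc : ∀ i, c i ≠ 0)
    (hcW : ∀ (w : P.weylGroup) (i : ι), c (w • i) = c i) (f : QRing b) (w : P.weylGroup) {i : ι}
    (hi : b.IsPos i) :
    (1 : QRing b) ⊗ₜ[ℂ] (c i • tens P (xb P i) 1) * qY b c f w -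
      qY b c f w * (1 : QRing b) ⊗ₜ[ℂ] (c i • tens P (xb P i) 1) =
    f ⊗ₜ[ℂ] tens P (c i • (xb P i - xb P (w • i))) (nilY b c w) -
      if len b (w * s P i) + 1 = len b w then qY b c f (w * s P i) else 0 := by
  have h : c i • tens P (xb P i) 1 * tens P 1 (nilY b c w) -
      tens P 1 (nilY b c w) * (c i • tens P (xb P i) 1) =
      tens P (c i • (xb P i - xb P (w • i))) (nilY b c w) -
        tens P 1 (if len b (w * s P i) + 1 = len b w then nilY b c (w * s P i) else 0) := by
    have e : tens P (xb P i - xb P (w • i)) (nilY b c w) =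
        tens P (xb P i) (nilY b c w) - tens P (xb P (w • i)) (nilY b c w) :=
      TensorProduct.sub_tmul _ _ _
    rw [smul_mul_assoc, mul_smul_comm, left_mul, mul_one, nilY_mul_xb, ← DBt_nilY hc hcW w hi,
      tens_smul_right, tens_smul_left, e]
    module
  unfold qY
  rw [Algebra.TensorProduct.tmul_mul_tmul, Algebra.TensorProduct.tmul_mul_tmul, one_mul, mul_one,
    ← TensorProduct.tmul_sub, h, TensorProduct.tmul_sub]
  congr 1
  split_ifs
  · rfl
  · rw [tens_zero_right, TensorProduct.tmul_zero]

open Classical in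
/-- The products of two quantum corrections cancel for orthogonal roots. -/
theorem sum_qY_mul_qY [P.IsReduced] (hcW : ∀ (w : P.weylGroup) (i : ι), c (w • i) = c i)
    (x y : N) : ∑ p ∈ posRoots b ×ˢ posRoots b, wedge P x y p.1 p.2 •
        (qY b c (qcoef b p.1) (s P p.1) * qY b c (qcoef b p.2) (s P p.2)) =
      ∑ p ∈ (posRoots b ×ˢ posRoots b).filter (fun p => ObtusePair b p.1 p.2),
        wedge P x y p.1 p.2 • qY b c (qmon b p.1 * qmon b p.2) (s P p.1 * s P p.2) := by
  rw [← Finset.sum_filter_add_sum_filter_not _ (fun p : ι × ι => P.pairingIn ℤ p.1 p.2 < 0)]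
  have h1 : ∑ p ∈ (posRoots b ×ˢ posRoots b).filter (fun p => ¬P.pairingIn ℤ p.1 p.2 < 0),
      wedge P x y p.1 p.2 •
        (qY b c (qcoef b p.1) (s P p.1) * qY b c (qcoef b p.2) (s P p.2)) = 0 := by
    refine Finset.sum_involution (fun p _ => p.swap) ?_ ?_ ?_ ?_
    · rintro ⟨i, j⟩ hp
      simp only [Finset.mem_filter, Finset.mem_product, mem_posRoots] at hp
      obtain ⟨⟨hi, hj⟩, hp⟩ := hp
      simp only [Prod.fst_swap, Prod.snd_swap]
      by_cases h0 : P.pairingIn ℤ i j = 0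
      · have hcomm : s P i * s P j = s P j * s P i := by
          have e : s P i • j = j := by
            apply P.root.injective
            rw [root_s_smul, P.pairingIn_eq_zero_iff.1 h0, zero_smul, sub_zero]
          have h := s_smul P (s P i) j
          rw [e, s_inv] at h
          nth_rw 2 [h]
          rw [mul_assoc, s_mul_self, mul_one]
        rw [wedge_swap x y j i, qY_mul_qY hcW, qY_mul_qY hcW, hcomm, mul_comm (qcoef b j),
          add_comm (len b (s P j)), HR_neg_smul, add_neg_cancel]
      · have h2 : ∀ i j, b.IsPos i → b.IsPos j → 0 < P.pairingIn ℤ i j →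
            qY b c (qcoef b i) (s P i) * qY b c (qcoef b j) (s P j) = 0 := by
          intro i j hi hj hp
          rw [qY_mul_qY hcW, if_neg]
          intro h
          have := pairing_nonpos_of_len_eq hi hj h
          lia
        have h3 : 0 < P.pairingIn ℤ i j := by lia
        rw [h2 i j hi hj h3, h2 j i hj hi ((P.zero_lt_pairingIn_iff' (S := ℤ)).1 h3), smul_zero,
          smul_zero, add_zero]
    · rintro ⟨i, j⟩ _ hne h
      obtain rfl : j = i := congrArg Prod.fst h
      rw [wedge_self, zero_smul] at hne
      exact hne rfl
    · rintro ⟨i, j⟩ hp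
      simp only [Finset.mem_filter, Finset.mem_product, mem_posRoots] at hp ⊢
      refine ⟨hp.1.symm, fun h => hp.2 ?_⟩
      exact (P.pairingIn_lt_zero_iff ℤ).1 h
    · rintro p _
      exact p.swap_swap
  rw [h1, add_zero]
  refine (Finset.sum_subset_zero_on_sdiff ?_ ?_ ?_).symm
  · rintro ⟨i, j⟩ hp
    rw [Finset.mem_filter] at hp ⊢
    exact ⟨hp.1, hp.2.obtuse⟩
  · rintro ⟨i, j⟩ hp
    simp only [Finset.mem_sdiff, Finset.mem_filter, not_and] at hp
    obtain ⟨⟨hm, hp⟩, h⟩ := hp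
    have h' := h hm
    unfold qcoef
    by_cases hi : IsTilde b i
    · by_cases hj : IsTilde b j
      · rw [qY_mul_qY hcW, if_neg fun hl => h' ⟨hi, hj, hp, hl⟩, smul_zero]
      · rw [if_neg hj, qY_zero, mul_zero, smul_zero]
    · rw [if_neg hi, qY_zero, zero_mul, smul_zero]
  · rintro ⟨i, j⟩ hp
    rw [Finset.mem_filter] at hp
    have h := hp.2
    rw [qY_mul_qY hcW, if_pos h.len_eq, qcoef, qcoef, if_pos h.tilde_left, if_pos h.tilde_right]

open Classical in
/-- The commutators of the classical terms with the quantum corrections. -/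
theorem sum_commutator_qY [P.IsReduced] (hc : ∀ i, c i ≠ 0)
    (hcW : ∀ (w : P.weylGroup) (i : ι), c (w • i) = c i) (x y : N) :
    ∑ p ∈ posRoots b ×ˢ posRoots b, wedge P x y p.2 p.1 •
        ((1 : QRing b) ⊗ₜ[ℂ] (c p.2 • tens P (xb P p.2) 1) * qY b c (qcoef b p.1) (s P p.1) -
          qY b c (qcoef b p.1) (s P p.1) * (1 : QRing b) ⊗ₜ[ℂ] (c p.2 • tens P (xb P p.2) 1)) =
      -∑ p ∈ (posRoots b ×ˢ posRoots b).filter (fun p => DescentPair b p.1 p.2),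
        wedge P x y p.2 p.1 • qY b c (qmon b p.1) (s P p.1 * s P p.2) := by
  have h1 : ∀ p ∈ posRoots b ×ˢ posRoots b, wedge P x y p.2 p.1 •
        ((1 : QRing b) ⊗ₜ[ℂ] (c p.2 • tens P (xb P p.2) 1) * qY b c (qcoef b p.1) (s P p.1) -
          qY b c (qcoef b p.1) (s P p.1) * (1 : QRing b) ⊗ₜ[ℂ] (c p.2 • tens P (xb P p.2) 1)) =
      qcoef b p.1 ⊗ₜ[ℂ] tens P ((wedge P x y p.2 p.1 * c p.2) •
        (xb P p.2 - xb P (s P p.1 • p.2))) (nilY b c (s P p.1)) -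
      if DescentPair b p.1 p.2 then
        wedge P x y p.2 p.1 • qY b c (qmon b p.1) (s P p.1 * s P p.2) else 0 := by
    rintro ⟨j, i⟩ hp
    simp only [Finset.mem_product, mem_posRoots] at hp
    obtain ⟨hj, hi⟩ := hp
    simp only
    rw [commutator_qY hc hcW _ _ hi, smul_sub, mul_smul, tens_smul_left P (wedge P x y i j),
      TensorProduct.tmul_smul]
    congr 1
    by_cases h : DescentPair b j i
    · rw [if_pos h, if_pos h.len_eq, qcoef, if_pos h.tilde]
    · rw [if_neg h]
      by_cases ht : IsTilde b j
      · by_cases hij : i = j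
        · rw [hij, wedge_self, zero_smul]
        · rw [if_neg fun hl => h ⟨ht, hi, hij, hl⟩, smul_zero]
      · rw [qcoef, if_neg ht, qY_zero, ite_self, smul_zero]
  rw [Finset.sum_congr rfl h1, Finset.sum_sub_distrib, ← Finset.sum_filter, sub_eq_neg_self,
    Finset.sum_product]
  refine Finset.sum_eq_zero fun j _ => ?_
  have h2 := sum_wedge_sub_eq_zero (b := b) hcW x y j
  have h3 := congrArg (fun u => qcoef b j ⊗ₜ[ℂ] ((tensL P).flip (nilY b c (s P j)) u)) h2
  simp only [map_sum, map_zero, TensorProduct.tmul_sum, TensorProduct.tmul_zero] at h3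
  exact h3

/-- The commutator of `μ̃(x)` and `μ̃(y)` vanishes: the quantum corrections of both kinds are matched by
the bijection between the pairs `(α_1, α_2)` and the pairs `(β, γ)`. -/
theorem sum_wedge_qbr_mul_qbr [P.IsReduced] (hc : ∀ i, c i ≠ 0)
    (hcW : ∀ (w : P.weylGroup) (i : ι), c (w • i) = c i)
    {word : ι → List b.support} (hword : ∀ i, IsTilde b i → IsReducedWord b (s P i) (word i))
    (x y : N) : ∑ i ∈ posRoots b, ∑ j ∈ posRoots b,
      wedge P x y i j • (qbr b c word i * qbr b c word j) = 0 := by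
  classical
  let A : ι → HR b := fun i => (1 : QRing b) ⊗ₜ[ℂ] (c i • tens P (xb P i) 1)
  let K : ι → HR b := fun i => qY b c (qcoef b i) (s P i)
  have hsplit : ∀ i j, wedge P x y i j • (qbr b c word i * qbr b c word j) =
      wedge P x y i j • (A i * A j) + wedge P x y i j • (A i * K j) +
        wedge P x y i j • (K i * A j) + wedge P x y i j • (K i * K j) := by
    intro i j
    rw [qbr_eq hcW hword, qbr_eq hcW hword, add_mul, mul_add, mul_add, smul_add, smul_add,
      smul_add]
    abel
  have h00 : ∑ i ∈ posRoots b, ∑ j ∈ posRoots b, wedge P x y i j • (A i * A j) = 0 := by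
    have h := sum_wedge_mul_eq_zero (b := b) hcW x y
    have h3 := congrArg (fun u => (1 : QRing b) ⊗ₜ[ℂ] ((tensL P).flip 1 u)) h
    simp only [map_sum, map_zero, TensorProduct.tmul_sum, TensorProduct.tmul_zero] at h3
    rw [← h3]
    refine Finset.sum_congr rfl fun i _ => Finset.sum_congr rfl fun j _ => ?_
    change wedge P x y i j • ((1 : QRing b) ⊗ₜ[ℂ] (c i • tens P (xb P i) 1) *
      (1 : QRing b) ⊗ₜ[ℂ] (c j • tens P (xb P j) 1)) = _
    rw [Algebra.TensorProduct.tmul_mul_tmul, one_mul, smul_mul_smul_comm, left_mul,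
      ← TensorProduct.tmul_smul, smul_smul, map_smul]
    rfl
  have h01 : ∑ i ∈ posRoots b, ∑ j ∈ posRoots b, wedge P x y i j • (A i * K j) +
      ∑ i ∈ posRoots b, ∑ j ∈ posRoots b, wedge P x y i j • (K i * A j) =
      -∑ p ∈ (posRoots b ×ˢ posRoots b).filter (fun p => DescentPair b p.1 p.2),
        wedge P x y p.2 p.1 • qY b c (qmon b p.1) (s P p.1 * s P p.2) := by
    rw [← sum_commutator_qY hc hcW, Finset.sum_product, Finset.sum_comm,
      ← Finset.sum_add_distrib]
    refine Finset.sum_congr rfl fun i _ => ?_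
    rw [← Finset.sum_add_distrib]
    refine Finset.sum_congr rfl fun j _ => ?_
    rw [wedge_swap x y i j, HR_neg_smul, smul_sub, sub_eq_add_neg]
  have h11 : ∑ i ∈ posRoots b, ∑ j ∈ posRoots b, wedge P x y i j • (K i * K j) =
      ∑ p ∈ (posRoots b ×ˢ posRoots b).filter (fun p => ObtusePair b p.1 p.2),
        wedge P x y p.1 p.2 • qY b c (qmon b p.1 * qmon b p.2) (s P p.1 * s P p.2) := by
    rw [← sum_qY_mul_qY hcW, Finset.sum_product]
  have hbij : ∑ p ∈ (posRoots b ×ˢ posRoots b).filter (fun p => ObtusePair b p.1 p.2),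
        wedge P x y p.1 p.2 • qY b c (qmon b p.1 * qmon b p.2) (s P p.1 * s P p.2) =
      ∑ p ∈ (posRoots b ×ˢ posRoots b).filter (fun p => DescentPair b p.1 p.2),
        wedge P x y p.2 p.1 • qY b c (qmon b p.1) (s P p.1 * s P p.2) := by
    refine Finset.sum_nbij' (toDescent P) (toObtuse b) ?_ ?_ ?_ ?_ ?_
    · rintro ⟨i, j⟩ hp
      have h := (Finset.mem_filter.1 hp).2.toDescent
      exact Finset.mem_filter.2
        ⟨Finset.mem_product.2 ⟨mem_posRoots.2 h.tilde.1, mem_posRoots.2 h.pos⟩, h⟩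
    · rintro ⟨i, j⟩ hp
      have h := (Finset.mem_filter.1 hp).2.toObtuse
      exact Finset.mem_filter.2 ⟨Finset.mem_product.2
        ⟨mem_posRoots.2 h.tilde_left.1, mem_posRoots.2 h.tilde_right.1⟩, h⟩
    · rintro ⟨i, j⟩ hp
      exact (Finset.mem_filter.1 hp).2.toObtuse_toDescent
    · rintro ⟨i, j⟩ hp
      exact (Finset.mem_filter.1 hp).2.toDescent_toObtuse
    · rintro ⟨i, j⟩ hp
      have h : ObtusePair b i j := (Finset.mem_filter.1 hp).2
      rw [h.wedge_toDescent, s_mul_toDescent, h.qmon_toDescent]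
  simp only [hsplit, Finset.sum_add_distrib]
  rw [h00, zero_add, h01, h11, hbij, neg_add_cancel]

theorem muTilde_one_tmul (word : ι → List b.support) (x : N) :
    muTilde b c word ((1 : QRing b) ⊗ₜ[ℂ] x) =
      ∑ i ∈ posRoots b, P.toLinearMap (P.root i) x • qbr b c word i := by
  unfold muTilde
  rw [LinearMap.liftBaseChange_tmul, one_smul, LinearMap.sum_apply]
  rfl

theorem commute_muTilde_one_tmul [P.IsReduced] (hc : ∀ i, c i ≠ 0)
    (hcW : ∀ (w : P.weylGroup) (i : ι), c (w • i) = c i)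
    {word : ι → List b.support} (hword : ∀ i, IsTilde b i → IsReducedWord b (s P i) (word i))
    (x y : N) : Commute (muTilde b c word ((1 : QRing b) ⊗ₜ[ℂ] x))
      (muTilde b c word ((1 : QRing b) ⊗ₜ[ℂ] y)) := by
  have h := sum_wedge_qbr_mul_qbr hc hcW hword x y
  simp only [wedge, HR_sub_smul, Finset.sum_sub_distrib] at h
  rw [commute_iff_eq, muTilde_one_tmul, muTilde_one_tmul, Finset.sum_mul_sum, Finset.sum_mul_sum]
  simp only [smul_mul_smul_comm]
  exact sub_eq_zero.1 h

theorem commute_muTilde [P.IsReduced] (hc : ∀ i, c i ≠ 0)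
    (hcW : ∀ (w : P.weylGroup) (i : ι), c (w • i) = c i)
    {word : ι → List b.support} (hword : ∀ i, IsTilde b i → IsReducedWord b (s P i) (word i))
    (x y : QRing b ⊗[ℂ] N) : Commute (muTilde b c word x) (muTilde b c word y) := by
  have hone : ∀ (f : QRing b) (n : N), f ⊗ₜ[ℂ] n = f • ((1 : QRing b) ⊗ₜ[ℂ] n) := by
    intro f n
    rw [TensorProduct.smul_tmul', smul_eq_mul, mul_one]
  induction x using TensorProduct.induction_on with
  | zero => rw [map_zero]; exact Commute.zero_left _
  | add x x' hx hx' => rw [map_add]; exact hx.add_left hx'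
  | tmul f n =>
    rw [hone f n, map_smul]
    refine Commute.smul_left ?_ f
    induction y using TensorProduct.induction_on with
    | zero => rw [map_zero]; exact Commute.zero_right _
    | add y y' hy hy' => rw [map_add]; exact hy.add_right hy'
    | tmul g m =>
      rw [hone g m, map_smul]
      exact (commute_muTilde_one_tmul hc hcW hword n m).smul_right g

end RootNichols

end

theorem proposition1 {ι M N : Type*} [Finite ι] [AddCommGroup M] [Module ℂ M]
    [AddCommGroup N] [Module ℂ N] (P : RootPairing ι ℂ M N) [P.IsRootSystem]
    [P.IsCrystallographic] [P.IsReduced] (b : P.Base)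
    (c : ι → ℂ) (hc : ∀ i, c i ≠ 0) (hcW : ∀ (w : P.weylGroup) (i : ι), c (w • i) = c i)
    (word : ι → List b.support)
    (hword : ∀ i, RootNichols.IsTilde b i →
      RootNichols.IsReducedWord b (RootNichols.s P i) (word i)) :
    ∀ x ∈ Algebra.adjoin (RootNichols.QRing b)
        (Set.range (RootNichols.muTilde b c word)),
      ∀ y ∈ Algebra.adjoin (RootNichols.QRing b)
        (Set.range (RootNichols.muTilde b c word)),
        x * y = y * x := by
  intro x hx y hy
  refine Algebra.commute_of_mem_adjoin_of_forall_mem_commute hy ?_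
  rintro _ ⟨v, rfl⟩
  refine (Algebra.commute_of_mem_adjoin_of_forall_mem_commute hx ?_).symm
  rintro _ ⟨u, rfl⟩
  exact RootNichols.commute_muTilde hc hcW hword v u
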